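/- Let $K_1,K_2,K_3>0$, $K_4,t\in\mathbb R$, $L_1,L_2>0$ and $\Omega=(-L_1,L_1)\times(-L_2,L_2)\times(0,1)$. For $\mathbf n\in W^{1,2}(\Omega,\mathbb S^2)$ (that is, $\mathbf n\in W^{1,2}(\Omega,\mathbb R^3)$ with $|\mathbf n|=1$ almost everywhere) let $$I(\mathbf n)=\int_\Omega K_1(\nabla\cdot\mathbf n)^2+K_2(\mathbf n\cdot\nabla\times\mathbf n+t)^2+K_3|\mathbf n\times\nabla\times\mathbf n|^2+(K_2+K_4)\big(\mathrm{tr}((\nabla\mathbf n)^2)-(\nabla\cdot\mathbf n)^2\big)\,dx ,$$ and let $\mathcal A$ be the set of $\mathbf n\in W^{1,2}(\Omega,\mathbb S^2)$ which satisfy, in the sense of traces, $\mathbf n|_{z=0}=\mathbf e_1$, $\mathbf n|_{z=1}=\mathbf e_3$, $\mathbf n|_{x=-L_1}=\mathbf n|_{x=L_1}$ and $\mathbf n|_{y=-L_2}=\mathbf n|_{y=L_2}$. For $C\in\mathbb R$ put $$h_C(u)=\frac{\left(K_1\cos^2u+K_3\sin^2u\right)^{1/2}}{\left(C-\frac{K_2^2t^2\cos^2u}{K_2\cos^2u+K_3\sin^2u}\right)^{1/2}}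 .$$ There is exactly one $C\in\mathbb R$ such that $C-\frac{K_2^2t^2\cos^2u}{K_2\cos^2u+K_3\sin^2u}>0$ for all $u\in(0,\frac\pi2]$ and the integral $\int_0^{\pi/2}h_C(u)\,du$ converges and equals $1$; it satisfies $C>K_2t^2$. For this $C$ there is exactly one function $\theta^*:[0,1]\to\mathbb R$ with $$\int_0^{\theta^*(z)}h_C(u)\,du=z\quad(0\le z\le1),\qquad \theta^*(1)=\frac\pi2 ,$$ and exactly one function $\phi^*:[0,1]\to\mathbb R$ with $$(\phi^*)'=\frac{K_2t}{K_2\cos^2\theta^*+K_3\sin^2\theta^*}\ \text{ on }[0,1],\qquad \phi^*(0)=0 .$$ The director field $\mathbf n^*(x,y,z)=(\cos\phi^*(z)\cos\theta^*(z),\ \sin\phi^*(z)\cos\theta^*(z),\ \sin\theta^*(z))$ belongs to $\mathcal A$ and is the unique global minimiser of $I$ among the elements of $\mathcal A$ that depend only on $z$: for every such $\mathbf n$ one has $I(\mathbf n)\ge I(\mathbf n^*)$, with equality only if $\mathbf n=\mathbf n^*$ almost everywhere. -/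

import Mathlib

open MeasureTheory Set
open scoped ContDiff Matrix

noncomputable section

namespace OseenFrank

/-- Points of `ℝ³`, and also the values of director fields, as coordinate triples `(x, y, z)`
(indices `0, 1, 2`). Lengths are always written through the Euclidean dot product. -/
abbrev Vec3 := Fin 3 → ℝ

/-! ### The cuboid -/

/-- Lower corner `(-L₁, -L₂, 0)` of the cuboid. -/
def lo (L₁ L₂ : ℝ) : Vec3 := ![-L₁, -L₂, 0]

/-- Upper corner `(L₁, L₂, 1)` of the cuboid. -/
def hi (L₁ L₂ : ℝ) : Vec3 := ![L₁, L₂, 1]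

/-- The cuboid `Ω = (-L₁, L₁) × (-L₂, L₂) × (0, 1)`. -/
def cuboid (L₁ L₂ : ℝ) : Set Vec3 := {x | ∀ i, x i ∈ Ioo (lo L₁ L₂ i) (hi L₁ L₂ i)}

/-- The face of the cuboid orthogonal to the `j`-th axis, in terms of the two remaining
coordinates. Both opposite faces are copies of it: the point of the face `x j = s` with
remaining coordinates `y` is `j.insertNth s y`. -/
def face (L₁ L₂ : ℝ) (j : Fin 3) : Set (Fin 2 → ℝ) :=
  {y | ∀ k, y k ∈ Ioo (lo L₁ L₂ (j.succAbove k)) (hi L₁ L₂ (j.succAbove k))}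

/-! ### Weak gradients, the Sobolev space `W^{1,2}` and traces -/

/-- The classical partial derivative `∂ⱼ φ`. -/
def partialDeriv (φ : Vec3 → ℝ) (j : Fin 3) (x : Vec3) : ℝ := fderiv ℝ φ x (Pi.single j 1)

/-- `G` is a weak gradient of `n` on the open set `U`, where `G x i j` stands for `∂ⱼ nᵢ (x)`:
both are locally integrable and `∫ nᵢ ∂ⱼφ = -∫ (∂ⱼ nᵢ) φ` for all `φ ∈ C_c^∞(U)`. -/
def IsWeakGradient (U : Set Vec3) (n : Vec3 → Vec3) (G : Vec3 → Matrix (Fin 3) (Fin 3) ℝ) :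
    Prop :=
  (∀ i, LocallyIntegrableOn (fun x => n x i) U) ∧
  (∀ i j, LocallyIntegrableOn (fun x => G x i j) U) ∧
  ∀ φ : Vec3 → ℝ, ContDiff ℝ ∞ φ → HasCompactSupport φ → tsupport φ ⊆ U → ∀ i j,
    ∫ x in U, n x i * partialDeriv φ j x = -∫ x in U, G x i j * φ x

open Classical in
/-- The weak gradient `∇n` of `n` on `U` (unique up to null sets; `0` if there is none). -/
def weakGrad (U : Set Vec3) (n : Vec3 → Vec3) : Vec3 → Matrix (Fin 3) (Fin 3) ℝ :=
  if h : ∃ G, IsWeakGradient U n G then h.choose else fun _ => 0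

/-- `n ∈ W^{1,2}(U, ℝ³)`. -/
def MemW12 (U : Set Vec3) (n : Vec3 → Vec3) : Prop :=
  (∀ i, MemLp (fun x => n x i) 2 (volume.restrict U)) ∧
  (∃ G, IsWeakGradient U n G) ∧
  ∀ i j, MemLp (fun x => weakGrad U n x i j) 2 (volume.restrict U)

/-- `n ∈ W^{1,2}(U, 𝕊²)`. -/
def MemW12Sphere (U : Set Vec3) (n : Vec3 → Vec3) : Prop :=
  MemW12 U n ∧ ∀ᵐ x ∂(volume.restrict U), n x ⬝ᵥ n x = 1

/-- The traces of `n` on the two faces of the cuboid orthogonal to the `j`-th axis are the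
square integrable functions `gLo` (on the lower face) and `gHi` (on the upper face).
The traces of a Sobolev function are the functions on the faces for which the Gauss-Green
formula `∫_Ω nᵢ ∂ⱼφ + (∂ⱼ nᵢ) φ = ∫_{∂Ω} nᵢ φ νⱼ` holds for all `φ ∈ C_c^∞(ℝ³)`; here
`νⱼ` is `1` on the upper face, `-1` on the lower face, and `0` on the four other faces. -/
def HasTraces (L₁ L₂ : ℝ) (j : Fin 3) (n : Vec3 → Vec3) (gLo gHi : (Fin 2 → ℝ) → Vec3) : Prop :=
  (∀ i, MemLp (fun y => gLo y i) 2 (volume.restrict (face L₁ L₂ j))) ∧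
  (∀ i, MemLp (fun y => gHi y i) 2 (volume.restrict (face L₁ L₂ j))) ∧
  ∀ φ : Vec3 → ℝ, ContDiff ℝ ∞ φ → HasCompactSupport φ → ∀ i,
    ∫ x in cuboid L₁ L₂,
        (n x i * partialDeriv φ j x + weakGrad (cuboid L₁ L₂) n x i j * φ x) =
      (∫ y in face L₁ L₂ j, gHi y i * φ (j.insertNth (hi L₁ L₂ j) y)) -
      (∫ y in face L₁ L₂ j, gLo y i * φ (j.insertNth (lo L₁ L₂ j) y))

/-! ### Admissible fields and the Oseen-Frank energy -/

/-- The admissible set `𝒜`: fields `n ∈ W^{1,2}(Ω, 𝕊²)` with `n = e₁` at `z = 0`, `n = e₃` at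
`z = 1`, equal traces on the faces `x = ±L₁` and equal traces on the faces `y = ±L₂`. -/
def Admissible (L₁ L₂ : ℝ) (n : Vec3 → Vec3) : Prop :=
  MemW12Sphere (cuboid L₁ L₂) n ∧
  HasTraces L₁ L₂ 2 n (fun _ => ![1, 0, 0]) (fun _ => ![0, 0, 1]) ∧
  (∃ g, HasTraces L₁ L₂ 0 n g g) ∧
  (∃ g, HasTraces L₁ L₂ 1 n g g)

/-- `n` depends only on `z` (almost everywhere in the cuboid). -/
def DependsOnlyOnZ (L₁ L₂ : ℝ) (n : Vec3 → Vec3) : Prop :=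
  ∃ m : ℝ → Vec3, ∀ᵐ x ∂(volume.restrict (cuboid L₁ L₂)), n x = m (x 2)

/-- The divergence, from the gradient matrix `G i j = ∂ⱼ nᵢ`. -/
def divOf (G : Matrix (Fin 3) (Fin 3) ℝ) : ℝ := G.trace

/-- The curl, from the gradient matrix `G i j = ∂ⱼ nᵢ`. -/
def curlOf (G : Matrix (Fin 3) (Fin 3) ℝ) : Vec3 :=
  ![G 2 1 - G 1 2, G 0 2 - G 2 0, G 1 0 - G 0 1]

/-- The Oseen-Frank density
`w = K₁ (div n)² + K₂ (n · curl n + t)² + K₃ |n × curl n|² + (K₂ + K₄) (tr (∇n)² - (div n)²)`. -/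
def density (K₁ K₂ K₃ K₄ t : ℝ) (n : Vec3) (G : Matrix (Fin 3) (Fin 3) ℝ) : ℝ :=
  K₁ * divOf G ^ 2 + K₂ * (n ⬝ᵥ curlOf G + t) ^ 2
    + K₃ * (crossProduct n (curlOf G) ⬝ᵥ crossProduct n (curlOf G))
    + (K₂ + K₄) * ((G * G).trace - divOf G ^ 2)

/-- The Oseen-Frank energy `I(n) = ∫_Ω w(n, ∇n) dx`. -/
def energy (K₁ K₂ K₃ K₄ t L₁ L₂ : ℝ) (n : Vec3 → Vec3) : ℝ :=
  ∫ x in cuboid L₁ L₂, density K₁ K₂ K₃ K₄ t (n x) (weakGrad (cuboid L₁ L₂) n x)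

/-- `n` is the unique global minimiser (up to null sets) of the energy among the admissible
fields that depend only on `z`. -/
def IsUniqueMinimiser (K₁ K₂ K₃ K₄ t L₁ L₂ : ℝ) (n : Vec3 → Vec3) : Prop :=
  Admissible L₁ L₂ n ∧ DependsOnlyOnZ L₁ L₂ n ∧
  ∀ m, Admissible L₁ L₂ m → DependsOnlyOnZ L₁ L₂ m →
    energy K₁ K₂ K₃ K₄ t L₁ L₂ n ≤ energy K₁ K₂ K₃ K₄ t L₁ L₂ m ∧
    (energy K₁ K₂ K₃ K₄ t L₁ L₂ m = energy K₁ K₂ K₃ K₄ t L₁ L₂ n →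
      ∀ᵐ x ∂(volume.restrict (cuboid L₁ L₂)), m x = n x)

/-! ### The explicit minimiser -/

/-- The director field with Euler angles `θ(z)`, `φ(z)`. -/
def director (θ φ : ℝ → ℝ) (x : Vec3) : Vec3 :=
  ![Real.cos (φ (x 2)) * Real.cos (θ (x 2)),
    Real.sin (φ (x 2)) * Real.cos (θ (x 2)),
    Real.sin (θ (x 2))]

/-- The quantity `C - K₂² t² cos² u / (K₂ cos² u + K₃ sin² u)`. -/
def radicand (K₂ K₃ t C u : ℝ) : ℝ :=
  C - K₂ ^ 2 * t ^ 2 * Real.cos u ^ 2 / (K₂ * Real.cos u ^ 2 + K₃ * Real.sin u ^ 2)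

/-- The integrand
`(K₁ cos² u + K₃ sin² u)^{1/2} / (C - K₂² t² cos² u / (K₂ cos² u + K₃ sin² u))^{1/2}`. -/
def integrand (K₁ K₂ K₃ t C u : ℝ) : ℝ :=
  √(K₁ * Real.cos u ^ 2 + K₃ * Real.sin u ^ 2) / √(radicand K₂ K₃ t C u)

/-- `C` solves the normalisation equation `∫_0^{π/2} integrand = 1`; that the integral makes
sense (positive radicand on `(0, π/2]`, convergence) is part of the condition. -/
def IsNormalising (K₁ K₂ K₃ t C : ℝ) : Prop :=
  (∀ u ∈ Ioc 0 (Real.pi / 2), 0 < radicand K₂ K₃ t C u) ∧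
  IntervalIntegrable (integrand K₁ K₂ K₃ t C) volume 0 (Real.pi / 2) ∧
  ∫ u in (0 : ℝ)..(Real.pi / 2), integrand K₁ K₂ K₃ t C u = 1

/-- `θ` satisfies on `[0, 1]` the implicit equation `∫_0^{θ(z)} integrand = z`, and
`θ(1) = π/2`. -/
def IsTheta (K₁ K₂ K₃ t C : ℝ) (θ : ℝ → ℝ) : Prop :=
  (∀ z ∈ Icc (0 : ℝ) 1,
    IntervalIntegrable (integrand K₁ K₂ K₃ t C) volume 0 (θ z) ∧
    ∫ u in (0 : ℝ)..(θ z), integrand K₁ K₂ K₃ t C u = z) ∧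
  θ 1 = Real.pi / 2

/-- `φ` solves `φ' = K₂ t / (K₂ cos² θ + K₃ sin² θ)` on `[0, 1]` with `φ(0) = 0`. -/
def IsPhi (K₂ K₃ t : ℝ) (θ φ : ℝ → ℝ) : Prop :=
  (∀ z ∈ Icc (0 : ℝ) 1, HasDerivWithinAt φ
    (K₂ * t / (K₂ * Real.cos (θ z) ^ 2 + K₃ * Real.sin (θ z) ^ 2)) (Icc 0 1) z) ∧
  φ 0 = 0

end OseenFrank

end

/-! The proof is a calibration argument. For a field of `z` alone the `K₂ + K₄` term vanishes
pointwise, and in terms of the latitude `θ` and longitude `φ` the density is `A θ'² + K₂ t² - 2 K₂ t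
cos²θ φ' + B cos²θ φ'²`, with `A = K₁ cos²θ + K₃ sin²θ` and `B = K₂ cos²θ + K₃ sin²θ`. Completing
the square in `φ'`, adding and subtracting `C`, and then completing the square in `θ'` gives, with
`R` the radicand, `(K₂ t² - C) + 2 √A √R θ' + (√A θ' - √R)² + B cos²θ (φ' - K₂ t / B)²`. The first
two terms integrate to a quantity fixed by the boundary values `θ(0) = 0`, `θ(1) = π/2`. The
remaining `excess` is nonnegative and vanishes exactly when `θ' = √R / √A = 1 / h_C(θ)` and `φ' = K₂
t / B`. The constant `C` is the one for which the solution that starts at `0` reaches `π/2` at `z =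
1`. It exists and is unique because `∫ h_C` decreases strictly and continuously in `C > K₂ t²`, is
small for large `C`, and diverges logarithmically as `C` tends to `K₂ t²`.

Two points need care. A Sobolev competitor must first be turned into an absolutely continuous curve
`N` with the prescribed end values (`exists_profile`). Such a curve may pass through the poles,
where the longitude is undefined. Hence only the latitude `arcsin N₃` is used, which is absolutely
continuous because it is Lipschitz on the sphere (`abs_arcsin_sub_le`), while `cos²θ φ'` is replaced
by `N₁ N₂' - N₂ N₁'`. The identity is `excess_eq`, the poles are treated in `excess_of_cos_eq_zero`,
its integral is `IsProfile.integral_density`, and equality is resolved in `eqOn_euler`. -/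

noncomputable section

namespace OseenFrank

/-! ### Fubini on the cuboid -/

/-- The interval of the `j`-th coordinate of the cuboid. -/
abbrev side (L₁ L₂ : ℝ) (j : Fin 3) : Set ℝ := Ioo (lo L₁ L₂ j) (hi L₁ L₂ j)

lemma lo_lt_hi {L₁ L₂ : ℝ} (hL₁ : 0 < L₁) (hL₂ : 0 < L₂) (j : Fin 3) :
    lo L₁ L₂ j < hi L₁ L₂ j := by
  fin_cases j <;> simp [lo, hi] <;> linarith

lemma side_two (L₁ L₂ : ℝ) : side L₁ L₂ 2 = Ioo 0 1 := by simp [side, lo, hi]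

lemma cuboid_eq_pi (L₁ L₂ : ℝ) : cuboid L₁ L₂ = univ.pi (side L₁ L₂) := by
  ext x; simp [cuboid, side]

lemma face_eq_pi (L₁ L₂ : ℝ) (j : Fin 3) :
    face L₁ L₂ j = univ.pi (fun k => side L₁ L₂ (j.succAbove k)) := by
  ext x; simp [face, side]

lemma isOpen_cuboid (L₁ L₂ : ℝ) : IsOpen (cuboid L₁ L₂) := by
  rw [cuboid_eq_pi]
  exact isOpen_set_pi finite_univ fun _ _ => isOpen_Ioo

lemma measurableSet_cuboid (L₁ L₂ : ℝ) : MeasurableSet (cuboid L₁ L₂) :=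
  (isOpen_cuboid L₁ L₂).measurableSet

lemma measurableSet_face (L₁ L₂ : ℝ) (j : Fin 3) : MeasurableSet (face L₁ L₂ j) := by
  rw [face_eq_pi]
  exact (isOpen_set_pi finite_univ fun _ _ => isOpen_Ioo).measurableSet

lemma volume_face_lt_top (L₁ L₂ : ℝ) (j : Fin 3) : volume (face L₁ L₂ j) < ⊤ := by
  rw [face_eq_pi, volume_pi_pi]
  exact ENNReal.prod_lt_top fun i _ => by simp [side]

lemma volume_face_ne_zero {L₁ L₂ : ℝ} (hL₁ : 0 < L₁) (hL₂ : 0 < L₂) (j : Fin 3) :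
    volume (face L₁ L₂ j) ≠ 0 := by
  rw [face_eq_pi, volume_pi_pi]
  refine Finset.prod_ne_zero_iff.2 fun i _ => ?_
  simpa [side] using lo_lt_hi hL₁ hL₂ _

lemma volume_cuboid_lt_top (L₁ L₂ : ℝ) : volume (cuboid L₁ L₂) < ⊤ := by
  rw [cuboid_eq_pi, volume_pi_pi]
  exact ENNReal.prod_lt_top fun i _ => by simp [side]

instance (L₁ L₂ : ℝ) (j : Fin 3) : IsFiniteMeasure (volume.restrict (face L₁ L₂ j)) :=
  ⟨by simpa using volume_face_lt_top L₁ L₂ j⟩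

instance (L₁ L₂ : ℝ) : IsFiniteMeasure (volume.restrict (cuboid L₁ L₂)) :=
  ⟨by simpa using volume_cuboid_lt_top L₁ L₂⟩

/-- Insert the value `s` of the `j`-th coordinate. -/
abbrev ins (j : Fin 3) (s : ℝ) (y : Fin 2 → ℝ) : Vec3 := j.insertNth s y

lemma ins_two (s : ℝ) (y : Fin 2 → ℝ) : ins 2 s y 2 = s :=
  Fin.insertNth_apply_same (α := fun _ => ℝ) (2 : Fin 3) s y

lemma ins_of_ne {j : Fin 3} (hj : j ≠ 2) (s : ℝ) (y : Fin 2 → ℝ) : ins j s y 2 = y 1 := by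
  have h : (2 : Fin 3) = j.succAbove 1 := by
    fin_cases j
    · rfl
    · rfl
    · exact absurd rfl hj
  rw [h]
  exact Fin.insertNth_apply_succAbove (α := fun _ => ℝ) j s y 1

lemma continuous_ins (j : Fin 3) : Continuous fun p : ℝ × (Fin 2 → ℝ) => ins j p.1 p.2 := by
  refine continuous_pi fun i => ?_
  induction i using j.succAboveCases with
  | x => simpa [ins] using continuous_fst
  | p k => simp only [ins, Fin.insertNth_apply_succAbove]; fun_prop

lemma hasDerivAt_ins (j : Fin 3) (y : Fin 2 → ℝ) (s : ℝ) :
    HasDerivAt (fun s => ins j s y) (Pi.single j 1) s := by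
  refine hasDerivAt_pi.2 fun i => ?_
  induction i using j.succAboveCases with
  | x => simpa [ins] using hasDerivAt_id' s
  | p k => simpa [ins] using hasDerivAt_const s (y k)

lemma measurePreserving_ins (L₁ L₂ : ℝ) (j : Fin 3) :
    MeasurePreserving (fun p : ℝ × (Fin 2 → ℝ) => ins j p.1 p.2)
      ((volume.restrict (side L₁ L₂ j)).prod (volume.restrict (face L₁ L₂ j)))
      (volume.restrict (cuboid L₁ L₂)) := by
  have h := ((volume_preserving_piFinSuccAbove (fun _ : Fin 3 => ℝ) j).symm).restrict_preimage
    (measurableSet_cuboid L₁ L₂)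
  have hs : side L₁ L₂ j ×ˢ face L₁ L₂ j =
      (MeasurableEquiv.piFinSuccAbove (fun _ : Fin 3 => ℝ) j).symm ⁻¹' cuboid L₁ L₂ := by
    ext ⟨s, y⟩
    simp only [mem_prod, mem_preimage, cuboid, face, mem_ofPred_eq, side,
      MeasurableEquiv.piFinSuccAbove_symm_apply, Fin.insertNthEquiv_apply]
    rw [Fin.forall_iff_succAbove j]
    simp
  rw [Measure.prod_restrict, hs]
  exact h

lemma measurableEmbedding_ins (j : Fin 3) :
    MeasurableEmbedding (fun p : ℝ × (Fin 2 → ℝ) => ins j p.1 p.2) :=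
  (MeasurableEquiv.piFinSuccAbove (fun _ : Fin 3 => ℝ) j).symm.measurableEmbedding

lemma integrable_comp_ins {L₁ L₂ : ℝ} (j : Fin 3) {f : Vec3 → ℝ}
    (hf : IntegrableOn f (cuboid L₁ L₂)) :
    Integrable (fun p : ℝ × (Fin 2 → ℝ) => f (ins j p.1 p.2))
      ((volume.restrict (side L₁ L₂ j)).prod (volume.restrict (face L₁ L₂ j))) :=
  ((measurePreserving_ins L₁ L₂ j).integrable_comp_emb (measurableEmbedding_ins j)).2 hf

lemma setIntegral_cuboid {L₁ L₂ : ℝ} (j : Fin 3) {f : Vec3 → ℝ}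
    (hf : IntegrableOn f (cuboid L₁ L₂)) :
    ∫ x in cuboid L₁ L₂, f x = ∫ y in face L₁ L₂ j, ∫ s in side L₁ L₂ j, f (ins j s y) := by
  rw [← (measurePreserving_ins L₁ L₂ j).integral_comp (measurableEmbedding_ins j)]
  exact integral_prod_symm _ (integrable_comp_ins j hf)

lemma setIntegral_cuboid' {L₁ L₂ : ℝ} (j : Fin 3) {f : Vec3 → ℝ}
    (hf : IntegrableOn f (cuboid L₁ L₂)) :
    ∫ x in cuboid L₁ L₂, f x = ∫ s in side L₁ L₂ j, ∫ y in face L₁ L₂ j, f (ins j s y) := by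
  rw [← (measurePreserving_ins L₁ L₂ j).integral_comp (measurableEmbedding_ins j)]
  exact integral_prod _ (integrable_comp_ins j hf)

/-! ### Functions of the last coordinate -/

lemma map_cuboid_height (L₁ L₂ : ℝ) :
    (volume.restrict (cuboid L₁ L₂)).map (fun x : Vec3 => x 2) =
      volume (face L₁ L₂ 2) • volume.restrict (Ioo (0 : ℝ) 1) := by
  rw [← (measurePreserving_ins L₁ L₂ 2).map_eq, Measure.map_map (measurable_pi_apply 2)
    (measurableEmbedding_ins 2).measurable]
  have : (fun x : Vec3 => x 2) ∘ (fun p : ℝ × (Fin 2 → ℝ) => ins 2 p.1 p.2) = Prod.fst := by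
    ext p; exact ins_two _ _
  rw [this, Measure.map_fst_prod, side_two, Measure.restrict_apply_univ]

lemma quasiMeasurePreserving_height (L₁ L₂ : ℝ) :
    Measure.QuasiMeasurePreserving (fun x : Vec3 => x 2) (volume.restrict (cuboid L₁ L₂))
      (volume.restrict (Ioo (0 : ℝ) 1)) :=
  ⟨measurable_pi_apply 2, by
    rw [map_cuboid_height]; exact Measure.smul_absolutelyContinuous⟩

lemma ae_cuboid_of_ae {L₁ L₂ : ℝ} {p : ℝ → Prop} (h : ∀ᵐ z ∂volume.restrict (Ioo (0 : ℝ) 1), p z) :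
    ∀ᵐ x ∂volume.restrict (cuboid L₁ L₂), p (x 2) :=
  (quasiMeasurePreserving_height L₁ L₂).ae h

lemma ae_slices_of_ae_cuboid {L₁ L₂ : ℝ} {p : Vec3 → Prop}
    (h : ∀ᵐ x ∂volume.restrict (cuboid L₁ L₂), p x) :
    ∀ᵐ z ∂volume.restrict (Ioo (0 : ℝ) 1), ∀ᵐ y ∂volume.restrict (face L₁ L₂ 2),
      p (ins 2 z y) := by
  have := Measure.ae_ae_of_ae_prod
    ((measurePreserving_ins L₁ L₂ 2).quasiMeasurePreserving.ae h)
  rwa [side_two] at this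

lemma ae_of_ae_cuboid {L₁ L₂ : ℝ} (hL₁ : 0 < L₁) (hL₂ : 0 < L₂) {p : ℝ → Prop}
    (h : ∀ᵐ x ∂volume.restrict (cuboid L₁ L₂), p (x 2)) :
    ∀ᵐ z ∂volume.restrict (Ioo (0 : ℝ) 1), p z := by
  have : (ae (volume.restrict (face L₁ L₂ 2))).NeBot := by
    rw [ae_neBot, Ne, Measure.restrict_eq_zero]
    exact volume_face_ne_zero hL₁ hL₂ 2
  filter_upwards [ae_slices_of_ae_cuboid h] with z hz
  obtain ⟨y, hy⟩ := hz.exists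
  rwa [ins_two] at hy

lemma aestronglyMeasurable_comp_height {L₁ L₂ : ℝ} {f : ℝ → ℝ}
    (hf : AEStronglyMeasurable f (volume.restrict (Ioo (0 : ℝ) 1))) :
    AEStronglyMeasurable (fun x : Vec3 => f (x 2)) (volume.restrict (cuboid L₁ L₂)) :=
  hf.comp_quasiMeasurePreserving (quasiMeasurePreserving_height L₁ L₂)

lemma memLp_comp_height_iff {L₁ L₂ : ℝ} (hL₁ : 0 < L₁) (hL₂ : 0 < L₂) {f : ℝ → ℝ} {q : ENNReal}
    (hf : AEStronglyMeasurable f (volume.restrict (Ioo (0 : ℝ) 1))) :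
    MemLp (fun x : Vec3 => f (x 2)) q (volume.restrict (cuboid L₁ L₂)) ↔
      MemLp f q (volume.restrict (Ioo (0 : ℝ) 1)) := by
  have h := memLp_map_measure_iff (p := q) (μ := volume.restrict (cuboid L₁ L₂))
    (f := fun x : Vec3 => x 2) (g := f) (by
      rw [map_cuboid_height]; exact hf.smul_measure _) (measurable_pi_apply 2).aemeasurable
  rw [map_cuboid_height] at h
  refine h.symm.trans ⟨fun h' => ?_, fun h' => h'.smul_measure (volume_face_lt_top L₁ L₂ 2).ne⟩
  have := h'.smul_measure (c := (volume (face L₁ L₂ 2))⁻¹)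
    (ENNReal.inv_ne_top.2 (volume_face_ne_zero hL₁ hL₂ 2))
  rwa [smul_smul, ENNReal.inv_mul_cancel (volume_face_ne_zero hL₁ hL₂ 2)
    (volume_face_lt_top L₁ L₂ 2).ne, one_smul] at this

lemma setIntegral_comp_height {L₁ L₂ : ℝ} {f : ℝ → ℝ}
    (hf : AEStronglyMeasurable f (volume.restrict (Ioo (0 : ℝ) 1))) :
    ∫ x in cuboid L₁ L₂, f (x 2) =
      (volume (face L₁ L₂ 2)).toReal * ∫ z in Ioo (0 : ℝ) 1, f z := by
  have h := integral_map (μ := volume.restrict (cuboid L₁ L₂)) (φ := fun x : Vec3 => x 2)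
    (f := f) (measurable_pi_apply 2).aemeasurable (by
      rw [map_cuboid_height]; exact hf.smul_measure _)
  rw [← h, map_cuboid_height, integral_smul_measure, smul_eq_mul]

section

/-! ### Weak gradients -/

lemma isWeakGradient_weakGrad {U : Set Vec3} {n : Vec3 → Vec3} (h : ∃ G, IsWeakGradient U n G) :
    IsWeakGradient U n (weakGrad U n) := by
  rw [weakGrad, dif_pos h]
  exact h.choose_spec

lemma integrableOn_mul_of_tsupport_subset {U : Set Vec3} {f : Vec3 → ℝ}
    (hf : LocallyIntegrableOn f U) {φ : Vec3 → ℝ} (hφ : Continuous φ) (hc : HasCompactSupport φ)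
    (hs : tsupport φ ⊆ U) : IntegrableOn (fun x => f x * φ x) U := by
  have h := hf.integrableOn_compact_subset hs hc
  have h2 : IntegrableOn (fun x => f x * φ x) (tsupport φ) :=
    h.mul_continuousOn hφ.continuousOn hc
  refine ((integrableOn_iff_integrable_of_support_subset fun x hx => ?_).1 h2).integrableOn
  exact subset_tsupport φ fun h => hx (by simp [h])

/-- The fundamental lemma of the calculus of variations, applied entrywise. Since `weakGrad` is an
arbitrary choice, it can be computed only through this uniqueness. -/
lemma IsWeakGradient.ae_eq {U : Set Vec3} (hU : IsOpen U) {n : Vec3 → Vec3}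
    {G G' : Vec3 → Matrix (Fin 3) (Fin 3) ℝ} (h : IsWeakGradient U n G)
    (h' : IsWeakGradient U n G') : ∀ᵐ x ∂volume.restrict U, G x = G' x := by
  have key : ∀ i j, ∀ᵐ x ∂volume.restrict U, G x i j = G' x i j := by
    intro i j
    rw [ae_restrict_iff' hU.measurableSet]
    have := hU.ae_eq_zero_of_integral_contDiff_smul_eq_zero
      (f := fun x => G x i j - G' x i j) (μ := volume) ((h.2.1 i j).sub (h'.2.1 i j)) ?_
    · filter_upwards [this] with x hx hxU
      exact sub_eq_zero.1 (hx hxU)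
    intro φ hφ hc hs
    have e : ∫ x, φ x • (G x i j - G' x i j) = ∫ x in U, φ x • (G x i j - G' x i j) := by
      rw [setIntegral_eq_integral_of_forall_compl_eq_zero]
      intro x hx
      rw [image_eq_zero_of_notMem_tsupport (fun h => hx (hs h)), zero_smul]
    have e2 : ∀ x, φ x • (G x i j - G' x i j) = G x i j * φ x - G' x i j * φ x := by
      intro x; simp only [smul_eq_mul]; ring
    rw [e]
    simp_rw [e2]
    rw [integral_sub
      (integrableOn_mul_of_tsupport_subset (h.2.1 i j) hφ.continuous hc hs)
      (integrableOn_mul_of_tsupport_subset (h'.2.1 i j) hφ.continuous hc hs)]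
    have a := h.2.2 φ hφ hc hs i j
    have b := h'.2.2 φ hφ hc hs i j
    linarith
  filter_upwards [ae_all_iff.2 fun i => ae_all_iff.2 (key i)] with x hx
  ext i j
  exact hx i j

/-! ### Profiles: absolutely continuous functions of the last coordinate -/

/-- A curve that is absolutely continuous on `[0, 1]`. -/
def IsProfile (N : ℝ → Vec3) : Prop :=
  ∀ i, AbsolutelyContinuousOnInterval (fun z => N z i) 0 1

/-- The gradient of `x ↦ N (x 2)`. -/
def heightGrad (N : ℝ → Vec3) (x : Vec3) : Matrix (Fin 3) (Fin 3) ℝ :=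
  Matrix.of fun i j => if j = 2 then deriv (fun z => N z i) (x 2) else 0

variable {L₁ L₂ : ℝ} {N : ℝ → Vec3}

lemma IsProfile.continuousOn (hN : IsProfile N) (i : Fin 3) :
    ContinuousOn (fun z => N z i) (Icc 0 1) := by
  simpa using (hN i).continuousOn

lemma IsProfile.exists_bound (hN : IsProfile N) :
    ∃ B, ∀ i, ∀ z ∈ Icc (0 : ℝ) 1, |N z i| ≤ B := by
  choose B hB using fun i => (hN i).exists_bound
  refine ⟨∑ i, |B i|, fun i z hz => ?_⟩
  have := hB i z (by simpa using hz)
  rw [Real.norm_eq_abs] at this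
  exact (this.trans (le_abs_self _)).trans
    (Finset.single_le_sum (f := fun i => |B i|) (fun _ _ => abs_nonneg _) (Finset.mem_univ i))

lemma IsProfile.aestronglyMeasurable (hN : IsProfile N) (i : Fin 3) :
    AEStronglyMeasurable (fun z => N z i) (volume.restrict (Ioo (0 : ℝ) 1)) :=
  ((hN.continuousOn i).mono Ioo_subset_Icc_self).aestronglyMeasurable measurableSet_Ioo

lemma IsProfile.memLp_comp_height (hN : IsProfile N) (i : Fin 3) {q : ENNReal} :
    MemLp (fun x : Vec3 => N (x 2) i) q (volume.restrict (cuboid L₁ L₂)) := by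
  obtain ⟨B, hB⟩ := hN.exists_bound
  refine MemLp.of_bound (aestronglyMeasurable_comp_height (hN.aestronglyMeasurable i)) B ?_
  refine ae_cuboid_of_ae (p := fun z => ‖N z i‖ ≤ B) ?_
  filter_upwards [ae_restrict_mem measurableSet_Ioo] with z hz
  exact hB i z (Ioo_subset_Icc_self hz)

lemma IsProfile.integrableOn_deriv (hN : IsProfile N) (i : Fin 3) :
    IntegrableOn (deriv fun z => N z i) (Ioo (0 : ℝ) 1) := by
  rw [← intervalIntegrable_iff_integrableOn_Ioo_of_le zero_le_one]
  exact (hN i).intervalIntegrable_deriv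

lemma memLp_heightGrad (hL₁ : 0 < L₁) (hL₂ : 0 < L₂) {i : Fin 3} {q : ENNReal}
    (hN : MemLp (deriv fun z => N z i) q (volume.restrict (Ioo (0 : ℝ) 1))) (j : Fin 3) :
    MemLp (fun x : Vec3 => heightGrad N x i j) q (volume.restrict (cuboid L₁ L₂)) := by
  by_cases hj : j = 2
  · simpa [heightGrad, hj] using (memLp_comp_height_iff hL₁ hL₂ hN.1).2 hN
  · simp [heightGrad, hj]

lemma IsProfile.integrableOn_heightGrad (hL₁ : 0 < L₁) (hL₂ : 0 < L₂) (hN : IsProfile N)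
    (i j : Fin 3) : IntegrableOn (fun x : Vec3 => heightGrad N x i j) (cuboid L₁ L₂) :=
  (memLp_heightGrad hL₁ hL₂ (memLp_one_iff_integrable.2 (hN.integrableOn_deriv i)) j).integrable
    le_rfl

lemma ins_mem_Icc {j : Fin 3} {s : ℝ} (hs : s ∈ Icc (lo L₁ L₂ j) (hi L₁ L₂ j)) {y : Fin 2 → ℝ}
    (hy : y ∈ face L₁ L₂ j) : ins j s y 2 ∈ Icc (0 : ℝ) 1 := by
  by_cases hj : j = 2
  · subst hj
    rw [ins_two]
    simpa [lo, hi] using hs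
  · rw [ins_of_ne hj]
    have h := hy 1
    have h2 : j.succAbove 1 = 2 := by
      fin_cases j
      · rfl
      · rfl
      · exact absurd rfl hj
    rw [h2] at h
    simp [lo, hi] at h
    exact ⟨h.1.le, h.2.le⟩

lemma IsProfile.memLp_face (hN : IsProfile N) {j : Fin 3} {s : ℝ}
    (hs : s ∈ Icc (lo L₁ L₂ j) (hi L₁ L₂ j)) (i : Fin 3) (q : ENNReal) :
    MemLp (fun y => N (ins j s y 2) i) q (volume.restrict (face L₁ L₂ j)) := by
  obtain ⟨B, hB⟩ := hN.exists_bound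
  refine MemLp.of_bound ?_ B ?_
  · refine ContinuousOn.aestronglyMeasurable ?_ (measurableSet_face L₁ L₂ j)
    refine (hN.continuousOn i).comp (t := Icc 0 1) (f := fun y => ins j s y 2) ?_
      fun y hy => ins_mem_Icc hs hy
    exact ((continuous_apply 2).comp ((continuous_ins j).comp
      (Continuous.prodMk_right s))).continuousOn
  · filter_upwards [ae_restrict_mem (measurableSet_face L₁ L₂ j)] with y hy
    exact hB i _ (ins_mem_Icc hs hy)

lemma continuous_partialDeriv {φ : Vec3 → ℝ} (hφ : ContDiff ℝ ∞ φ) (j : Fin 3) :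
    Continuous (partialDeriv φ j) :=
  (hφ.continuous_fderiv (by simp)).clm_apply continuous_const

lemma hasCompactSupport_partialDeriv {φ : Vec3 → ℝ} (hc : HasCompactSupport φ) (j : Fin 3) :
    HasCompactSupport (partialDeriv φ j) :=
  hc.fderiv_apply (𝕜 := ℝ) _

lemma integrableOn_cuboid_mul {f φ : Vec3 → ℝ}
    (hf : IntegrableOn f (cuboid L₁ L₂)) (hφ : Continuous φ)
    (hc : HasCompactSupport φ) : IntegrableOn (fun x => f x * φ x) (cuboid L₁ L₂) := by
  obtain ⟨B, hB⟩ := hφ.bounded_above_of_compact_support hc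
  exact hf.mul_bdd hφ.aestronglyMeasurable (Filter.Eventually.of_forall hB)

/-- Gauss-Green formula for functions of the last coordinate. -/
lemma IsProfile.gauss_green (hL₁ : 0 < L₁) (hL₂ : 0 < L₂) (hN : IsProfile N) {φ : Vec3 → ℝ}
    (hφ : ContDiff ℝ ∞ φ) (hc : HasCompactSupport φ) (i j : Fin 3) :
    ∫ x in cuboid L₁ L₂, (N (x 2) i * partialDeriv φ j x + heightGrad N x i j * φ x) =
      (∫ y in face L₁ L₂ j, N (ins j (hi L₁ L₂ j) y 2) i * φ (ins j (hi L₁ L₂ j) y)) -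
      (∫ y in face L₁ L₂ j, N (ins j (lo L₁ L₂ j) y 2) i * φ (ins j (lo L₁ L₂ j) y)) := by
  have hlt := lo_lt_hi hL₁ hL₂ j
  have hint : IntegrableOn
      (fun x => N (x 2) i * partialDeriv φ j x + heightGrad N x i j * φ x) (cuboid L₁ L₂) :=
    (integrableOn_cuboid_mul ((hN.memLp_comp_height i).integrable le_rfl)
      (continuous_partialDeriv hφ j) (hasCompactSupport_partialDeriv hc j)).add
    (integrableOn_cuboid_mul (hN.integrableOn_heightGrad hL₁ hL₂ i j)
      hφ.continuous hc)
  have hb : ∀ s ∈ Icc (lo L₁ L₂ j) (hi L₁ L₂ j), IntegrableOn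
      (fun y => N (ins j s y 2) i * φ (ins j s y)) (face L₁ L₂ j) := by
    intro s hs
    obtain ⟨B, hB⟩ := hφ.continuous.bounded_above_of_compact_support hc
    refine ((hN.memLp_face hs i 1).integrable le_rfl).mul_bdd ?_
      (Filter.Eventually.of_forall fun y => hB _)
    exact (hφ.continuous.comp ((continuous_ins j).comp
      (Continuous.prodMk_right s))).aestronglyMeasurable
  rw [setIntegral_cuboid j hint, ← integral_sub (hb _ (right_mem_Icc.2 hlt.le))
    (hb _ (left_mem_Icc.2 hlt.le))]
  refine setIntegral_congr_fun (measurableSet_face L₁ L₂ j) fun y hy => ?_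
  rw [← integral_Ioc_eq_integral_Ioo, ← intervalIntegral.integral_of_le hlt.le]
  -- By Fubini it remains to integrate by parts on each line parallel to the `j`-th axis.
  have hv : ∀ s, HasDerivAt (fun s => φ (ins j s y)) (partialDeriv φ j (ins j s y)) s := fun s =>
    ((hφ.differentiable (by simp)).differentiableAt.hasFDerivAt.comp_hasDerivAt s
      (hasDerivAt_ins j y s))
  have hvac : AbsolutelyContinuousOnInterval (fun s => φ (ins j s y))
      (lo L₁ L₂ j) (hi L₁ L₂ j) := by
    refine ContDiffOn.absolutelyContinuousOnInterval (ContDiff.contDiffOn ?_)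
    rw [contDiff_one_iff_deriv]
    refine ⟨fun s => (hv s).differentiableAt, ?_⟩
    rw [show deriv (fun s => φ (ins j s y)) = fun s => partialDeriv φ j (ins j s y) from
      funext fun s => (hv s).deriv]
    exact (continuous_partialDeriv hφ j).comp ((continuous_ins j).comp (Continuous.prodMk_left y))
  -- Along such a line the field is the profile itself if `j = 2`, and constant otherwise.
  have hu : AbsolutelyContinuousOnInterval (fun s => N (ins j s y 2) i)
      (lo L₁ L₂ j) (hi L₁ L₂ j) ∧
      ∀ s, deriv (fun s => N (ins j s y 2) i) s = heightGrad N (ins j s y) i j := by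
    by_cases hj : j = 2
    · subst hj
      simp only [ins_two, heightGrad, Matrix.of_apply, if_true, implies_true, and_true]
      simpa [lo, hi] using (hN i)
    · simp only [ins_of_ne hj, heightGrad, Matrix.of_apply, hj, if_false, deriv_const,
        implies_true, and_true]
      exact ContDiffOn.absolutelyContinuousOnInterval contDiffOn_const
  rw [← hu.1.integral_deriv_mul_eq_sub hvac]
  refine intervalIntegral.integral_congr fun s _ => ?_
  simp only [hu.2, (hv s).deriv]
  ring

lemma IsProfile.isWeakGradient (hL₁ : 0 < L₁) (hL₂ : 0 < L₂) (hN : IsProfile N) {n : Vec3 → Vec3}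
    (hn : ∀ᵐ x ∂volume.restrict (cuboid L₁ L₂), n x = N (x 2)) :
    IsWeakGradient (cuboid L₁ L₂) n (heightGrad N) := by
  refine ⟨fun i => ?_, fun i j => ?_, fun φ hφ hc hs i j => ?_⟩
  · refine IntegrableOn.locallyIntegrableOn
      (((hN.memLp_comp_height i).integrable (q := 1) le_rfl).congr ?_)
    filter_upwards [hn] with x hx using by rw [hx]
  · exact IntegrableOn.locallyIntegrableOn
      (hN.integrableOn_heightGrad hL₁ hL₂ i j)
  · have h := hN.gauss_green hL₁ hL₂ hφ hc i j
    have hz : ∀ s y, s ∉ side L₁ L₂ j → φ (ins j s y) = 0 := by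
      intro s y hs'
      refine image_eq_zero_of_notMem_tsupport fun h => hs' ?_
      have := hs h j
      simpa [ins] using this
    simp only [hz _ _ right_notMem_Ioo, hz _ _ left_notMem_Ioo, mul_zero, integral_zero,
      sub_zero] at h
    rw [integral_add (integrableOn_cuboid_mul ((hN.memLp_comp_height i).integrable le_rfl)
      (continuous_partialDeriv hφ j) (hasCompactSupport_partialDeriv hc j))
      (integrableOn_cuboid_mul (hN.integrableOn_heightGrad hL₁ hL₂ i j)
      hφ.continuous hc)] at h
    rw [← eq_neg_of_add_eq_zero_left h]
    refine integral_congr_ae ?_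
    filter_upwards [hn] with x hx using by rw [hx]

lemma IsProfile.weakGrad_ae_eq (hL₁ : 0 < L₁) (hL₂ : 0 < L₂) (hN : IsProfile N) {n : Vec3 → Vec3}
    (hn : ∀ᵐ x ∂volume.restrict (cuboid L₁ L₂), n x = N (x 2)) :
    ∀ᵐ x ∂volume.restrict (cuboid L₁ L₂), weakGrad (cuboid L₁ L₂) n x = heightGrad N x :=
  (isWeakGradient_weakGrad ⟨_, hN.isWeakGradient hL₁ hL₂ hn⟩).ae_eq (isOpen_cuboid L₁ L₂)
    (hN.isWeakGradient hL₁ hL₂ hn)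

lemma IsProfile.hasTraces (hL₁ : 0 < L₁) (hL₂ : 0 < L₂) (hN : IsProfile N) {n : Vec3 → Vec3}
    (hn : ∀ᵐ x ∂volume.restrict (cuboid L₁ L₂), n x = N (x 2)) (j : Fin 3) :
    HasTraces L₁ L₂ j n (fun y => N (ins j (lo L₁ L₂ j) y 2))
      (fun y => N (ins j (hi L₁ L₂ j) y 2)) := by
  have hle := (lo_lt_hi hL₁ hL₂ j).le
  refine ⟨fun i => hN.memLp_face (left_mem_Icc.2 hle) i 2,
    fun i => hN.memLp_face (right_mem_Icc.2 hle) i 2, fun φ hφ hc i => ?_⟩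
  rw [← hN.gauss_green hL₁ hL₂ hφ hc i j]
  refine integral_congr_ae ?_
  filter_upwards [hn, hN.weakGrad_ae_eq hL₁ hL₂ hn] with x hx hx' using by rw [hx, hx']

/-- A profile on the sphere joining `e₁` to `e₃` is admissible. -/
lemma IsProfile.admissible (hL₁ : 0 < L₁) (hL₂ : 0 < L₂) (hN : IsProfile N)
    (hD : ∀ i, MemLp (deriv fun z => N z i) 2 (volume.restrict (Ioo (0 : ℝ) 1)))
    (h1 : ∀ z, N z ⬝ᵥ N z = 1) (h0 : N 0 = ![1, 0, 0]) (h1' : N 1 = ![0, 0, 1]) :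
    Admissible L₁ L₂ (fun x => N (x 2)) := by
  have hn : ∀ᵐ x ∂volume.restrict (cuboid L₁ L₂), (fun x : Vec3 => N (x 2)) x = N (x 2) :=
    Filter.Eventually.of_forall fun _ => rfl
  refine ⟨⟨⟨fun i => hN.memLp_comp_height i, ⟨_, hN.isWeakGradient hL₁ hL₂ hn⟩, fun i j => ?_⟩,
    Filter.Eventually.of_forall fun _ => h1 _⟩, ?_, ?_, ?_⟩
  · refine (memLp_congr_ae ?_).2 (memLp_heightGrad hL₁ hL₂ (hD i) j)
    filter_upwards [hN.weakGrad_ae_eq hL₁ hL₂ hn] with x hx using by rw [hx]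
  · have := hN.hasTraces hL₁ hL₂ hn 2
    simpa only [ins_two, lo, hi, Matrix.cons_val, h0, h1'] using this
  -- On a lateral face the height is one of the remaining coordinates, so opposite faces carry the
  -- same trace.
  · have := hN.hasTraces hL₁ hL₂ hn 0
    simp only [ins_of_ne (show (0 : Fin 3) ≠ 2 by decide)] at this
    exact ⟨_, this⟩
  · have := hN.hasTraces hL₁ hL₂ hn 1
    simp only [ins_of_ne (show (1 : Fin 3) ≠ 2 by decide)] at this
    exact ⟨_, this⟩

end

section

variable {L₁ L₂ : ℝ}

/-! ### From admissible fields to profiles -/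

/-- The average of `f` over the horizontal slice at height `z`. -/
def sliceMean (L₁ L₂ : ℝ) (f : Vec3 → ℝ) (z : ℝ) : ℝ :=
  (volume (face L₁ L₂ 2)).toReal⁻¹ * ∫ y in face L₁ L₂ 2, f (ins 2 z y)

lemma toReal_volume_face_pos (hL₁ : 0 < L₁) (hL₂ : 0 < L₂) :
    0 < (volume (face L₁ L₂ 2)).toReal :=
  ENNReal.toReal_pos (volume_face_ne_zero hL₁ hL₂ 2) (volume_face_lt_top L₁ L₂ 2).ne

lemma integrableOn_sliceMean {f : Vec3 → ℝ} (hf : IntegrableOn f (cuboid L₁ L₂)) :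
    IntegrableOn (sliceMean L₁ L₂ f) (Ioo 0 1) := by
  have := (integrable_comp_ins 2 hf).integral_prod_left
  rw [side_two] at this
  exact this.const_mul _

lemma integral_mul_comp_height (hL₁ : 0 < L₁) (hL₂ : 0 < L₂) {f : Vec3 → ℝ} {ψ : ℝ → ℝ}
    (hf : IntegrableOn (fun x => f x * ψ (x 2)) (cuboid L₁ L₂)) :
    ∫ x in cuboid L₁ L₂, f x * ψ (x 2) =
      (volume (face L₁ L₂ 2)).toReal * ∫ z in Ioo (0 : ℝ) 1, sliceMean L₁ L₂ f z * ψ z := by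
  rw [setIntegral_cuboid' 2 hf, side_two, ← integral_const_mul]
  refine integral_congr_ae (Filter.Eventually.of_forall fun z => ?_)
  simp only [ins_two, sliceMean]
  rw [integral_mul_const, ← mul_assoc, mul_inv_cancel_left₀ (toReal_volume_face_pos hL₁ hL₂).ne']

lemma sliceMean_ae_eq (hL₁ : 0 < L₁) (hL₂ : 0 < L₂) {f : Vec3 → ℝ} {M : ℝ → ℝ}
    (hf : ∀ᵐ x ∂volume.restrict (cuboid L₁ L₂), f x = M (x 2)) :
    ∀ᵐ z ∂volume.restrict (Ioo (0 : ℝ) 1), sliceMean L₁ L₂ f z = M z := by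
  filter_upwards [ae_slices_of_ae_cuboid hf] with z hz
  rw [sliceMean, integral_congr_ae hz]
  simp only [ins_two, integral_const, smul_eq_mul, measureReal_def, Measure.restrict_apply_univ]
  rw [inv_mul_cancel_left₀ (toReal_volume_face_pos hL₁ hL₂).ne']

/-- A smooth function of the last coordinate agrees near the closed cuboid with a test function. -/
lemma exists_testFunction_eq_comp_height (L₁ L₂ : ℝ) {ψ : ℝ → ℝ} (hψ : ContDiff ℝ ∞ ψ) :
    ∃ φ : Vec3 → ℝ, ContDiff ℝ ∞ φ ∧ HasCompactSupport φ ∧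
      ∀ x : Vec3, (∀ i, x i ∈ Icc (lo L₁ L₂ i) (hi L₁ L₂ i)) →
        φ x = ψ (x 2) ∧ partialDeriv φ 2 x = deriv ψ (x 2) := by
  -- `R` exceeds `|L₁|`, `|L₂|` and `1`, so the closed cuboid lies in the open sup-norm ball of
  -- radius `R`, on which the bump equals `1`. Values and derivatives are therefore unaffected by
  -- the cut-off.
  set R : ℝ := |L₁| + |L₂| + 2 with hR
  have hR0 : 0 < R := by positivity
  let χ : ContDiffBump (0 : Vec3) := ⟨R, R + 1, hR0, by linarith⟩
  refine ⟨fun x => χ x * ψ (x 2), χ.contDiff.mul (hψ.comp (contDiff_apply ℝ ℝ 2)),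
    χ.hasCompactSupport.mul_right, fun x hx => ?_⟩
  have hxR : x ∈ Metric.ball (0 : Vec3) R := by
    rw [mem_ball_zero_iff, pi_norm_lt_iff hR0]
    intro i
    have := hx i
    rw [Real.norm_eq_abs, abs_lt]
    have h1 := neg_abs_le L₁
    have h2 := le_abs_self L₁
    have h3 := neg_abs_le L₂
    have h4 := le_abs_self L₂
    have h5 := abs_nonneg L₁
    have h6 := abs_nonneg L₂
    fin_cases i <;> simp [lo, hi] at this ⊢ <;> constructor <;> linarith
  have hev : ∀ x ∈ Metric.ball (0 : Vec3) R, χ x * ψ (x 2) = ψ (x 2) := fun x hx => by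
    rw [χ.one_of_mem_closedBall (Metric.ball_subset_closedBall hx), one_mul]
  refine ⟨hev x hxR, ?_⟩
  have h : (fun x => χ x * ψ (x 2)) =ᶠ[nhds x] fun x => ψ (x 2) :=
    Filter.eventually_of_mem (Metric.isOpen_ball.mem_nhds hxR) hev
  have hd : HasFDerivAt (fun x : Vec3 => ψ (x 2)) _ x :=
    ((hψ.differentiable (by simp)).differentiableAt.hasDerivAt).comp_hasFDerivAt x
      (ContinuousLinearMap.proj (R := ℝ) (φ := fun _ : Fin 3 => ℝ) 2).hasFDerivAt
  rw [partialDeriv, h.fderiv_eq, hd.fderiv]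
  simp

lemma eqOn_of_ae_eq_of_continuousOn {f g : ℝ → ℝ} (hf : ContinuousOn f (Icc 0 1))
    (hg : ContinuousOn g (Icc 0 1)) (h : ∀ᵐ z ∂volume.restrict (Ioo (0 : ℝ) 1), f z = g z) :
    EqOn f g (Icc 0 1) := by
  have := Measure.eqOn_open_of_ae_eq (μ := volume) h isOpen_Ioo (hf.mono Ioo_subset_Icc_self)
    (hg.mono Ioo_subset_Icc_self)
  refine this.of_subset_closure hf hg Ioo_subset_Icc_self ?_
  rw [closure_Ioo zero_ne_one]

/-- A function on `(0, 1)` whose distributional derivative is `g`, with boundary values `a` and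
`b`, is the primitive of `g`. -/
lemma ae_eq_primitive {f g : ℝ → ℝ} {a b : ℝ} (hf : IntegrableOn f (Ioo 0 1))
    (hg : IntegrableOn g (Ioo 0 1))
    (h : ∀ ψ : ℝ → ℝ, ContDiff ℝ ∞ ψ →
      (∫ z in Ioo (0 : ℝ) 1, f z * deriv ψ z) + ∫ z in Ioo (0 : ℝ) 1, g z * ψ z =
        b * ψ 1 - a * ψ 0) :
    (∀ᵐ z ∂volume.restrict (Ioo (0 : ℝ) 1), f z = a + ∫ s in (0 : ℝ)..z, g s) ∧
      a + ∫ s in (0 : ℝ)..1, g s = b := by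
  have hg' : IntervalIntegrable g volume 0 1 :=
    (intervalIntegrable_iff_integrableOn_Ioo_of_le zero_le_one).2 hg
  set P : ℝ → ℝ := fun z => a + ∫ s in (0 : ℝ)..z, g s with hP
  have hPac : AbsolutelyContinuousOnInterval P 0 1 :=
    (ContDiffOn.absolutelyContinuousOnInterval contDiffOn_const).fun_add
      (hg'.absolutelyContinuousOnInterval_intervalIntegral left_mem_uIcc)
  have hPd : ∀ᵐ z, z ∈ Ioo (0 : ℝ) 1 → deriv P z = g z := by
    filter_upwards [hg'.ae_hasDerivAt_integral] with z hz hz'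
    rw [uIcc_of_le zero_le_one] at hz
    exact ((hz (Ioo_subset_Icc_self hz') 0 (left_mem_Icc.2 zero_le_one)).const_add a).deriv
  have hPc : ContinuousOn P (Icc 0 1) := by simpa using hPac.continuousOn
  have hPi : IntegrableOn P (Ioo 0 1) :=
    (hPc.integrableOn_Icc).mono_set Ioo_subset_Icc_self
  have mulc : ∀ {u v : ℝ → ℝ}, IntegrableOn u (Ioo 0 1) → Continuous v →
      IntegrableOn (fun z => u z * v z) (Ioo 0 1) := by
    intro u v hu hv
    obtain ⟨B, hB⟩ := isCompact_Icc.exists_bound_of_continuousOn (s := Icc (0 : ℝ) 1)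
      hv.continuousOn
    refine hu.mul_bdd hv.aestronglyMeasurable (c := B) ?_
    filter_upwards [ae_restrict_mem measurableSet_Ioo] with z hz
    exact hB z (Ioo_subset_Icc_self hz)
  -- Subtract the integration by parts for the primitive `P`. The terms at `0` cancel because `P 0 =
  -- a`.
  have main : ∀ ψ : ℝ → ℝ, ContDiff ℝ ∞ ψ →
      ∫ z in Ioo (0 : ℝ) 1, (f z - P z) * deriv ψ z = (b - P 1) * ψ 1 := by
    intro ψ hψ
    have hψc : Continuous (deriv ψ) := hψ.continuous_deriv (by simp)
    have hψac : AbsolutelyContinuousOnInterval ψ 0 1 :=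
      ContDiffOn.absolutelyContinuousOnInterval
        (hψ.contDiffOn.of_le (by exact_mod_cast le_top))
    have e := hPac.integral_deriv_mul_eq_sub hψac
    rw [intervalIntegral.integral_of_le zero_le_one, integral_Ioc_eq_integral_Ioo] at e
    have e2 : ∫ z in Ioo (0 : ℝ) 1, deriv P z * ψ z + P z * deriv ψ z =
        ∫ z in Ioo (0 : ℝ) 1, g z * ψ z + P z * deriv ψ z := by
      refine integral_congr_ae ?_
      filter_upwards [(ae_restrict_iff' measurableSet_Ioo).2 hPd] with z hz
      rw [hz]
    rw [e2, integral_add (mulc hg hψ.continuous) (mulc hPi hψc)] at e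
    simp_rw [sub_mul]
    rw [integral_sub (mulc hf hψc) (mulc hPi hψc)]
    have := h ψ hψ
    have hP0 : P 0 = a := by simp [hP]
    rw [hP0] at e
    linarith
  have hae : ∀ᵐ z ∂volume.restrict (Ioo (0 : ℝ) 1), f z = P z := by
    rw [ae_restrict_iff' measurableSet_Ioo]
    have := isOpen_Ioo.ae_eq_zero_of_integral_contDiff_smul_eq_zero (U := Ioo (0 : ℝ) 1)
      (f := fun z => f z - P z) (μ := volume) (hf.sub hPi).locallyIntegrableOn ?_
    · filter_upwards [this] with z hz hzU
      exact sub_eq_zero.1 (hz hzU)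
    intro χ hχ hc hs
    -- The test function is the primitive of `χ` based at `1`, so that the boundary term in `main`
    -- vanishes.
    have hd : ∀ z, HasDerivAt (fun z => ∫ s in (1 : ℝ)..z, χ s) (χ z) z := fun z =>
      intervalIntegral.integral_hasDerivAt_right (hχ.continuous.intervalIntegrable _ _)
        (hχ.continuous.stronglyMeasurableAtFilter _ _) hχ.continuous.continuousAt
    have hd' : deriv (fun z => ∫ s in (1 : ℝ)..z, χ s) = χ := funext fun z => (hd z).deriv
    have := main (fun z => ∫ s in (1 : ℝ)..z, χ s) (by
      rw [contDiff_infty_iff_deriv, hd']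
      exact ⟨fun z => (hd z).differentiableAt, hχ⟩)
    rw [hd'] at this
    simp only [intervalIntegral.integral_same, mul_zero] at this
    rw [← this, setIntegral_eq_integral_of_forall_compl_eq_zero]
    · simp only [smul_eq_mul, mul_comm]
    · intro x hx
      rw [image_eq_zero_of_notMem_tsupport (fun h => hx (hs h)), mul_zero]
  refine ⟨hae, ?_⟩
  -- Now that `f = P` almost everywhere, the test function `z` isolates the boundary value at `1`.
  have h1 := main (fun z => z) contDiff_id
  have h0 : ∫ z in Ioo (0 : ℝ) 1, (f z - P z) * deriv (fun z : ℝ => z) z = 0 := by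
    refine integral_eq_zero_of_ae ?_
    filter_upwards [hae] with z hz
    simp [hz]
  rw [h0] at h1
  linarith

/-- A Sobolev field that depends only on the last coordinate and has constant traces at bottom and
top is given by a profile. -/
lemma exists_profile (hL₁ : 0 < L₁) (hL₂ : 0 < L₂) {n : Vec3 → Vec3} {a b : Vec3}
    (hn : MemW12 (cuboid L₁ L₂) n) (hz : DependsOnlyOnZ L₁ L₂ n)
    (ht : HasTraces L₁ L₂ 2 n (fun _ => a) (fun _ => b)) :
    ∃ N : ℝ → Vec3, IsProfile N ∧
      (∀ i, MemLp (deriv fun z => N z i) 2 (volume.restrict (Ioo (0 : ℝ) 1))) ∧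
      (∀ᵐ x ∂volume.restrict (cuboid L₁ L₂), n x = N (x 2)) ∧ N 0 = a ∧ N 1 = b := by
  obtain ⟨M, hM⟩ := hz
  set G := weakGrad (cuboid L₁ L₂) n with hG
  set κ := (volume (face L₁ L₂ 2)).toReal with hκ
  have hκ0 : 0 < κ := toReal_volume_face_pos hL₁ hL₂
  have hni : ∀ i, IntegrableOn (fun x => n x i) (cuboid L₁ L₂) := fun i =>
    (hn.1 i).integrable (by norm_num)
  have hGi : ∀ i, IntegrableOn (fun x => G x i 2) (cuboid L₁ L₂) := fun i =>
    (hn.2.2 i 2).integrable (by norm_num)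
  -- Test functions of the height alone reduce Gauss-Green to one dimension, up to the common factor
  -- `κ`. They need not vanish at the bottom and top, so the identity carries the boundary values as
  -- well as the weak derivative.
  have key : ∀ i, _ := fun i => ae_eq_primitive (a := a i) (b := b i)
    (integrableOn_sliceMean (hni i)) (integrableOn_sliceMean (hGi i)) fun ψ hψ => by
      obtain ⟨φ, hφ, hc, hφψ⟩ := exists_testFunction_eq_comp_height L₁ L₂ hψ
      have h := ht.2.2 φ hφ hc i
      have hI1 := integrableOn_cuboid_mul (hni i) (continuous_partialDeriv hφ 2)
        (hasCompactSupport_partialDeriv hc 2)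
      have hI2 := integrableOn_cuboid_mul (hGi i) hφ.continuous hc
      have c1 : EqOn (fun x => n x i * partialDeriv φ 2 x) (fun x => n x i * deriv ψ (x 2))
          (cuboid L₁ L₂) := fun x hx => by
        simp only
        rw [(hφψ x fun i => Ioo_subset_Icc_self (hx i)).2]
      have c2 : EqOn (fun x => G x i 2 * φ x) (fun x => G x i 2 * ψ (x 2))
          (cuboid L₁ L₂) := fun x hx => by
        simp only
        rw [(hφψ x fun i => Ioo_subset_Icc_self (hx i)).1]
      rw [integral_add hI1 hI2, setIntegral_congr_fun (measurableSet_cuboid L₁ L₂) c1,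
        setIntegral_congr_fun (measurableSet_cuboid L₁ L₂) c2,
        integral_mul_comp_height hL₁ hL₂ (hI1.congr_fun c1 (measurableSet_cuboid L₁ L₂)),
        integral_mul_comp_height hL₁ hL₂ (hI2.congr_fun c2 (measurableSet_cuboid L₁ L₂))] at h
      have hface : ∀ s ∈ Icc (0 : ℝ) 1, ∀ c : ℝ,
          ∫ y in face L₁ L₂ 2, c * φ (ins 2 s y) = κ * (c * ψ s) := by
        intro s hs c
        have : EqOn (fun y => c * φ (ins 2 s y)) (fun _ => c * ψ s) (face L₁ L₂ 2) := by
          intro y hy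
          simp only
          rw [(hφψ (ins 2 s y) ?_).1, ins_two]
          rw [Fin.forall_iff_succAbove 2]
          refine ⟨by simpa [lo, hi] using hs, fun k => ?_⟩
          simpa using Ioo_subset_Icc_self (hy k)
        rw [setIntegral_congr_fun (measurableSet_face L₁ L₂ 2) this]
        simp [measureReal_def, hκ]
      have hhi : hi L₁ L₂ 2 = 1 := rfl
      have hlo : lo L₁ L₂ 2 = 0 := rfl
      rw [hhi, hlo] at h
      erw [hface 1 (by simp), hface 0 (by simp)] at h
      refine mul_left_cancel₀ hκ0.ne' ?_
      rw [mul_sub, ← h, ← mul_add]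
  set N : ℝ → Vec3 := fun z i =>
    a i + ∫ s in (0 : ℝ)..z, sliceMean L₁ L₂ (fun x => G x i 2) s with hN
  have hprof : IsProfile N := fun i =>
    (ContDiffOn.absolutelyContinuousOnInterval contDiffOn_const).fun_add
      (((intervalIntegrable_iff_integrableOn_Ioo_of_le zero_le_one).2
        (integrableOn_sliceMean (hGi i))).absolutelyContinuousOnInterval_intervalIntegral
          left_mem_uIcc)
  have hnN : ∀ᵐ x ∂volume.restrict (cuboid L₁ L₂), n x = N (x 2) := by
    have h1 : ∀ i, ∀ᵐ z ∂volume.restrict (Ioo (0 : ℝ) 1), M z i = N z i := fun i => by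
      filter_upwards [(key i).1, sliceMean_ae_eq hL₁ hL₂ (f := fun x => n x i)
        (M := fun z => M z i) (by filter_upwards [hM] with x hx using by rw [hx])] with z hz hz'
      rw [← hz', hz]
    filter_upwards [hM, ae_cuboid_of_ae (ae_all_iff.2 h1)] with x hx hx'
    rw [hx]
    exact funext hx'
  refine ⟨N, hprof, fun i => ?_, hnN, ?_, ?_⟩
  · rw [← memLp_comp_height_iff hL₁ hL₂ (hprof.integrableOn_deriv i).1]
    refine (memLp_congr_ae ?_).1 (hn.2.2 i 2)
    filter_upwards [hprof.weakGrad_ae_eq hL₁ hL₂ hnN] with x hx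
    rw [hx]
    simp [heightGrad]
  · ext i; simp [hN]
  · ext i; exact (key i).2

end

section

/-! ### Absolute continuity of compositions -/

/-- The variation sums of `f` are dominated by those of the `g i`. Several dominating functions are
allowed because the latitude is controlled only by all three coordinates together. -/
lemma absolutelyContinuousOnInterval_of_dist_le {ι : Type*} [Fintype ι] {f : ℝ → ℝ}
    {g : ι → ℝ → ℝ} {a b K : ℝ} (hg : ∀ i, AbsolutelyContinuousOnInterval (g i) a b)
    (h : ∀ x ∈ uIcc a b, ∀ y ∈ uIcc a b, dist (f x) (f y) ≤ K * ∑ i, dist (g i x) (g i y)) :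
    AbsolutelyContinuousOnInterval f a b := by
  have hlim := (tendsto_finsetSum Finset.univ fun i _ => hg i).const_mul K
  simp only [Finset.sum_const_zero, mul_zero] at hlim
  refine squeeze_zero' (Filter.Eventually.of_forall fun E =>
    Finset.sum_nonneg fun _ _ => dist_nonneg) ?_ hlim
  have hmem : ∀ᶠ E in AbsolutelyContinuousOnInterval.totalLengthFilter ⊓
      Filter.principal (AbsolutelyContinuousOnInterval.disjWithin a b),
      E ∈ AbsolutelyContinuousOnInterval.disjWithin a b :=
    Filter.eventually_inf_principal.2 (Filter.Eventually.of_forall fun _ h => h)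
  filter_upwards [hmem] with E hE
  rw [Finset.sum_comm, Finset.mul_sum]
  exact Finset.sum_le_sum fun k hk => h _ (hE.1 k hk).1 _ (hE.1 k hk).2

/-- The range of `θ` is bounded, and a `C¹` function is Lipschitz on a bounded interval. -/
lemma absolutelyContinuousOnInterval_comp {F θ : ℝ → ℝ} {a b : ℝ}
    (hF : ContDiff ℝ 1 F) (hθ : AbsolutelyContinuousOnInterval θ a b) :
    AbsolutelyContinuousOnInterval (fun z => F (θ z)) a b := by
  obtain ⟨D, hD⟩ := hθ.exists_bound
  obtain ⟨K, hK⟩ := (hF.contDiffOn (s := Icc (-D) D)).exists_lipschitzOnWith (by decide)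
    (convex_Icc _ _) isCompact_Icc
  refine absolutelyContinuousOnInterval_of_dist_le (ι := Unit) (g := fun _ => θ) (K := K)
    (fun _ => hθ) fun x hx y hy => ?_
  simpa using hK.dist_le_mul _ (abs_le.1 (hD x hx)) _ (abs_le.1 (hD y hy))

lemma contDiff_one_primitive {f : ℝ → ℝ} (hf : Continuous f) (a : ℝ) :
    ContDiff ℝ 1 (fun x => ∫ u in a..x, f u) := by
  have hd : ∀ z, HasDerivAt (fun z => ∫ s in a..z, f s) (f z) z := fun z =>
    intervalIntegral.integral_hasDerivAt_right (hf.intervalIntegrable _ _)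
      (hf.stronglyMeasurableAtFilter _ _) hf.continuousAt
  rw [contDiff_one_iff_deriv, show deriv (fun z => ∫ s in a..z, f s) = f from
    funext fun z => (hd z).deriv]
  exact ⟨fun z => (hd z).differentiableAt, hf⟩

lemma hasDerivAt_primitive {f : ℝ → ℝ} (hf : Continuous f) (a z : ℝ) :
    HasDerivAt (fun x => ∫ u in a..x, f u) (f z) z :=
  intervalIntegral.integral_hasDerivAt_right (hf.intervalIntegrable _ _)
    (hf.stronglyMeasurableAtFilter _ _) hf.continuousAt

/-! ### Latitude on the sphere -/

lemma dotProduct_eq (a b : Vec3) : a ⬝ᵥ b = a 0 * b 0 + a 1 * b 1 + a 2 * b 2 := by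
  simp [dotProduct, Fin.sum_univ_three]

/-- Although `arcsin` is not Lipschitz at `±1`, latitude is Lipschitz on the sphere. Cauchy-Schwarz
on the horizontal parts gives `cos (α - β) ≥ a · b`, that is `1 - cos (α - β) ≤ |a - b|² / 2`. The
bound `cos x ≤ 1 - 2 x² / π²` on `[-π, π]` turns this into `|α - β| ≤ (π / 2) |a - b|`. -/
lemma abs_arcsin_sub_le {a b : Vec3} (ha : a ⬝ᵥ a = 1) (hb : b ⬝ᵥ b = 1) :
    |Real.arcsin (a 2) - Real.arcsin (b 2)| ≤ Real.pi / 2 * ∑ i, |a i - b i| := by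
  rw [dotProduct_eq] at ha hb
  set α := Real.arcsin (a 2) with hα
  set β := Real.arcsin (b 2) with hβ
  have sα : Real.sin α = a 2 := Real.sin_arcsin (by nlinarith [sq_nonneg (a 0), sq_nonneg (a 1)])
    (by nlinarith [sq_nonneg (a 0), sq_nonneg (a 1)])
  have sβ : Real.sin β = b 2 := Real.sin_arcsin (by nlinarith [sq_nonneg (b 0), sq_nonneg (b 1)])
    (by nlinarith [sq_nonneg (b 0), sq_nonneg (b 1)])
  have cα : 0 ≤ Real.cos α := Real.cos_arcsin_nonneg _
  have cβ : 0 ≤ Real.cos β := Real.cos_arcsin_nonneg _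
  have cα2 : Real.cos α ^ 2 = a 0 ^ 2 + a 1 ^ 2 := by
    have := Real.sin_sq_add_cos_sq α; rw [sα] at this; linarith
  have cβ2 : Real.cos β ^ 2 = b 0 ^ 2 + b 1 ^ 2 := by
    have := Real.sin_sq_add_cos_sq β; rw [sβ] at this; linarith
  have hcs : a 0 * b 0 + a 1 * b 1 ≤ Real.cos α * Real.cos β := by
    refine le_of_abs_le (abs_le_of_sq_le_sq ?_ (mul_nonneg cα cβ))
    rw [mul_pow, cα2, cβ2]
    linarith [sq_nonneg (a 0 * b 1 - a 1 * b 0)]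
  have hpi := Real.pi_pos
  have hrange : |α - β| ≤ Real.pi := by
    have h1 := Real.arcsin_le_pi_div_two (a 2)
    have h2 := Real.neg_pi_div_two_le_arcsin (a 2)
    have h3 := Real.arcsin_le_pi_div_two (b 2)
    have h4 := Real.neg_pi_div_two_le_arcsin (b 2)
    rw [abs_le]; constructor <;> linarith
  have hcos := Real.cos_le_one_sub_mul_cos_sq hrange
  rw [Real.cos_sub, sα, sβ] at hcos
  refine abs_le_of_sq_le_sq ?_ (by positivity)
  rw [mul_pow, Fin.sum_univ_three]
  have h5 : (α - β) ^ 2 ≤ (Real.pi / 2) ^ 2 *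
      ((a 0 - b 0) ^ 2 + (a 1 - b 1) ^ 2 + (a 2 - b 2) ^ 2) := by
    have h6 : 2 / Real.pi ^ 2 * (α - β) ^ 2 ≤
        ((a 0 - b 0) ^ 2 + (a 1 - b 1) ^ 2 + (a 2 - b 2) ^ 2) / 2 := by linarith
    have h7 : (α - β) ^ 2 = Real.pi ^ 2 / 2 * (2 / Real.pi ^ 2 * (α - β) ^ 2) := by
      field_simp
    rw [h7]
    calc _ ≤ Real.pi ^ 2 / 2 *
          (((a 0 - b 0) ^ 2 + (a 1 - b 1) ^ 2 + (a 2 - b 2) ^ 2) / 2) := by gcongr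
      _ = _ := by ring
  refine h5.trans (mul_le_mul_of_nonneg_left ?_ (by positivity))
  rw [← sq_abs (a 0 - b 0), ← sq_abs (a 1 - b 1), ← sq_abs (a 2 - b 2)]
  linarith [
    mul_nonneg (abs_nonneg (a 0 - b 0)) (abs_nonneg (a 1 - b 1)),
    mul_nonneg (abs_nonneg (a 0 - b 0)) (abs_nonneg (a 2 - b 2)),
    mul_nonneg (abs_nonneg (a 1 - b 1)) (abs_nonneg (a 2 - b 2))]

lemma IsProfile.absolutelyContinuous_arcsin {N : ℝ → Vec3} (hN : IsProfile N)
    (h1 : ∀ z ∈ Icc (0 : ℝ) 1, N z ⬝ᵥ N z = 1) :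
    AbsolutelyContinuousOnInterval (fun z => Real.arcsin (N z 2)) 0 1 := by
  refine absolutelyContinuousOnInterval_of_dist_le (K := Real.pi / 2) hN fun x hx y hy => ?_
  rw [uIcc_of_le zero_le_one] at hx hy
  simp only [Real.dist_eq]
  exact abs_arcsin_sub_le (h1 x hx) (h1 y hy)

/-! ### The energy density in terms of the latitude -/

/-- The coefficient `a cos² u + b sin² u`. -/
def mix (a b u : ℝ) : ℝ := a * Real.cos u ^ 2 + b * Real.sin u ^ 2

lemma mix_pos {a b : ℝ} (ha : 0 < a) (hb : 0 < b) (u : ℝ) : 0 < mix a b u := by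
  have h := Real.sin_sq_add_cos_sq u
  rcases (sq_nonneg (Real.cos u)).eq_or_lt with h0 | h0
  · have : Real.sin u ^ 2 = 1 := by linarith
    simp [mix, ← h0, this, hb]
  · have := mul_pos ha h0
    have := mul_nonneg hb.le (sq_nonneg (Real.sin u))
    unfold mix; linarith

lemma continuous_mix (a b : ℝ) : Continuous (mix a b) := by unfold mix; fun_prop

lemma radicand_eq (K₂ K₃ t C u : ℝ) :
    radicand K₂ K₃ t C u = C - K₂ ^ 2 * t ^ 2 * Real.cos u ^ 2 / mix K₂ K₃ u := rfl

lemma integrand_eq (K₁ K₂ K₃ t C u : ℝ) :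
    integrand K₁ K₂ K₃ t C u = √(mix K₁ K₃ u) / √(radicand K₂ K₃ t C u) := rfl

lemma continuous_radicand {K₂ K₃ : ℝ} (hK₂ : 0 < K₂) (hK₃ : 0 < K₃) (t C : ℝ) :
    Continuous (radicand K₂ K₃ t C) := by
  simp only [funext (radicand_eq K₂ K₃ t C)]
  exact continuous_const.sub ((by fun_prop : Continuous fun u : ℝ =>
    K₂ ^ 2 * t ^ 2 * Real.cos u ^ 2).div (continuous_mix _ _) fun u => (mix_pos hK₂ hK₃ u).ne')

/-- The subtracted quotient is at most `K₂ t²`, its value at `u = 0`. -/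
lemma radicand_pos {K₂ K₃ t C : ℝ} (hK₂ : 0 < K₂) (hK₃ : 0 < K₃) (hC : K₂ * t ^ 2 < C) (u : ℝ) :
    0 < radicand K₂ K₃ t C u := by
  rw [radicand_eq, sub_pos]
  refine lt_of_le_of_lt ?_ hC
  rw [div_le_iff₀ (mix_pos hK₂ hK₃ u), mix]
  have : 0 ≤ K₂ * t ^ 2 * (K₃ * Real.sin u ^ 2) := by positivity
  linarith

/-- The gradient of a field that depends only on the last coordinate, with derivative `d`. -/
def zGrad (d : Vec3) : Matrix (Fin 3) (Fin 3) ℝ := Matrix.of fun i j => if j = 2 then d i else 0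

/-- `K₄` disappears because `tr (G²)` and `(div n)²` both equal `d 2 ^ 2`. -/
lemma density_zGrad (K₁ K₂ K₃ K₄ t : ℝ) (n d : Vec3) :
    density K₁ K₂ K₃ K₄ t n (zGrad d) =
      K₁ * d 2 ^ 2 + K₂ * (t - (n 0 * d 1 - n 1 * d 0)) ^ 2 +
        K₃ * ((n 2 * d 0) ^ 2 + (n 2 * d 1) ^ 2 + (n 0 * d 0 + n 1 * d 1) ^ 2) := by
  simp [density, divOf, curlOf, zGrad, Matrix.trace, Matrix.mul_apply, Fin.sum_univ_three,
    dotProduct, crossProduct]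
  ring

/-- The excess of the density over the calibration `K₂ t² - C + 2 √A √R θ'`. -/
def excess (K₁ K₂ K₃ K₄ t C : ℝ) (n d : Vec3) (u τ : ℝ) : ℝ :=
  density K₁ K₂ K₃ K₄ t n (zGrad d) - (K₂ * t ^ 2 - C) -
    2 * (√(mix K₁ K₃ u) * √(radicand K₂ K₃ t C u)) * τ

variable {K₁ K₂ K₃ K₄ t C : ℝ}

/-- The two completed squares. The expression `n 0 * d 1 - n 1 * d 0` plays the role of `cos² u`
times the longitudinal speed, so no choice of longitude is required. -/
lemma excess_eq (hK₁ : 0 < K₁) (hK₂ : 0 < K₂) (hK₃ : 0 < K₃) (hC : K₂ * t ^ 2 < C) {n d : Vec3}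
    {u τ : ℝ} (h1 : n ⬝ᵥ n = 1) (h0 : n ⬝ᵥ d = 0) (hu : n 2 = Real.sin u)
    (hτ : d 2 = Real.cos u * τ) (hc : Real.cos u ≠ 0) :
    excess K₁ K₂ K₃ K₄ t C n d u τ =
      (√(mix K₁ K₃ u) * τ - √(radicand K₂ K₃ t C u)) ^ 2 +
        Real.cos u ^ 2 * mix K₂ K₃ u *
          ((n 0 * d 1 - n 1 * d 0) / Real.cos u ^ 2 - K₂ * t / mix K₂ K₃ u) ^ 2 := by
  have hB := mix_pos hK₂ hK₃ u
  have hA2 := Real.sq_sqrt (mix_pos hK₁ hK₃ u).le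
  have hR2 := Real.sq_sqrt (radicand_pos hK₂ hK₃ hC u).le
  rw [dotProduct_eq] at h1 h0
  have hsc := Real.sin_sq_add_cos_sq u
  have hr : n 0 ^ 2 + n 1 ^ 2 = Real.cos u ^ 2 := by rw [hu] at h1; linarith
  set p := n 0 * d 1 - n 1 * d 0 with hp
  have hq : n 0 * d 0 + n 1 * d 1 = -(Real.sin u * Real.cos u * τ) := by
    rw [hu, hτ] at h0; linarith
  -- Lagrange's identity splits the horizontal velocity into an angular and a radial part; the
  -- radial part is known from `n · d = 0`.
  have hdd : d 0 ^ 2 + d 1 ^ 2 = p ^ 2 / Real.cos u ^ 2 + (Real.sin u * τ) ^ 2 := by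
    have : (n 0 ^ 2 + n 1 ^ 2) * (d 0 ^ 2 + d 1 ^ 2) =
        p ^ 2 + (n 0 * d 0 + n 1 * d 1) ^ 2 := by rw [hp]; ring
    rw [hr, hq] at this
    field_simp
    linarith
  have hexp : (√(mix K₁ K₃ u) * τ - √(radicand K₂ K₃ t C u)) ^ 2 =
      mix K₁ K₃ u * τ ^ 2 + radicand K₂ K₃ t C u -
        2 * (√(mix K₁ K₃ u) * √(radicand K₂ K₃ t C u)) * τ := by
    calc _ = √(mix K₁ K₃ u) ^ 2 * τ ^ 2 + √(radicand K₂ K₃ t C u) ^ 2 -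
        2 * (√(mix K₁ K₃ u) * √(radicand K₂ K₃ t C u)) * τ := by ring
      _ = _ := by rw [hA2, hR2]
  rw [hexp, excess, density_zGrad, ← hp, hq, radicand_eq]
  have e : (n 2 * d 0) ^ 2 + (n 2 * d 1) ^ 2 =
      Real.sin u ^ 2 * (p ^ 2 / Real.cos u ^ 2 + (Real.sin u * τ) ^ 2) := by
    rw [← hdd, hu]; ring
  rw [e, hτ]
  have hBdef : K₃ * Real.sin u ^ 2 = mix K₂ K₃ u - K₂ * Real.cos u ^ 2 := by rw [mix]; ring
  have hK : K₃ * (Real.sin u ^ 2 * (p ^ 2 / Real.cos u ^ 2 + (Real.sin u * τ) ^ 2) +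
      (-(Real.sin u * Real.cos u * τ)) ^ 2) =
      K₃ * Real.sin u ^ 2 * (p ^ 2 / Real.cos u ^ 2) + K₃ * Real.sin u ^ 2 * τ ^ 2 := by
    linear_combination (K₃ * Real.sin u ^ 2 * τ ^ 2) * hsc
  rw [hK, show mix K₁ K₃ u * τ ^ 2 = K₁ * Real.cos u ^ 2 * τ ^ 2 + K₃ * Real.sin u ^ 2 * τ ^ 2 by
    rw [mix]; ring, hBdef]
  generalize mix K₂ K₃ u = B at *
  field_simp
  ring

/-- At a pole the twist term is exactly `K₂ t²`, so the excess is at least `C > 0`. Strictness later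
shows that a curve of zero excess avoids the poles almost everywhere. -/
lemma excess_of_cos_eq_zero (hK₂ : 0 < K₂) (hK₃ : 0 < K₃) (hK₁ : 0 < K₁) (hC : K₂ * t ^ 2 < C)
    {n d : Vec3} {u : ℝ} (h1 : n ⬝ᵥ n = 1) (hu : n 2 = Real.sin u) (hc : Real.cos u = 0) :
    0 < excess K₁ K₂ K₃ K₄ t C n d u 0 := by
  rw [dotProduct_eq] at h1
  have hsc := Real.sin_sq_add_cos_sq u
  have hr : n 0 ^ 2 + n 1 ^ 2 = 0 := by
    rw [hu] at h1; rw [hc] at hsc; linarith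
  have hn0 : n 0 = 0 :=
    pow_eq_zero_iff two_ne_zero |>.1 (by linarith [sq_nonneg (n 0), sq_nonneg (n 1)])
  have hn1 : n 1 = 0 :=
    pow_eq_zero_iff two_ne_zero |>.1 (by linarith [sq_nonneg (n 0), sq_nonneg (n 1)])
  rw [excess, density_zGrad, hn0, hn1]
  have : 0 ≤ K₁ * d 2 ^ 2 := by positivity
  have : 0 ≤ K₃ * ((n 2 * d 0) ^ 2 + (n 2 * d 1) ^ 2 + (0 * d 0 + 0 * d 1) ^ 2) := by positivity
  have : 0 ≤ K₂ * t ^ 2 := by positivity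
  simp only [zero_mul, sub_zero, mul_zero] at *
  linarith

end

section

variable {K₁ K₂ K₃ t C : ℝ}

/-! ### The integrand of the implicit equation -/

lemma continuous_integrand (hK₂ : 0 < K₂) (hK₃ : 0 < K₃) (hC : K₂ * t ^ 2 < C) :
    Continuous (integrand K₁ K₂ K₃ t C) := by
  simp only [funext (integrand_eq K₁ K₂ K₃ t C)]
  exact (continuous_mix _ _).sqrt.div (continuous_radicand hK₂ hK₃ t C).sqrt fun u =>
    (Real.sqrt_pos.2 (radicand_pos hK₂ hK₃ hC u)).ne'

lemma integrand_pos (hK₁ : 0 < K₁) (hK₂ : 0 < K₂) (hK₃ : 0 < K₃) (hC : K₂ * t ^ 2 < C) (u : ℝ) :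
    0 < integrand K₁ K₂ K₃ t C u :=
  div_pos (Real.sqrt_pos.2 (mix_pos hK₁ hK₃ u)) (Real.sqrt_pos.2 (radicand_pos hK₂ hK₃ hC u))

lemma min_le_mix (a b u : ℝ) : min a b ≤ mix a b u := by
  have h := Real.sin_sq_add_cos_sq u
  have h1 := mul_le_mul_of_nonneg_right (min_le_left a b) (sq_nonneg (Real.cos u))
  have h2 := mul_le_mul_of_nonneg_right (min_le_right a b) (sq_nonneg (Real.sin u))
  have : min a b = min a b * Real.cos u ^ 2 + min a b * Real.sin u ^ 2 := by
    rw [← mul_add, add_comm, h, mul_one]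
  unfold mix; linarith

lemma mix_le_add {a b : ℝ} (ha : 0 < a) (hb : 0 < b) (u : ℝ) : mix a b u ≤ a + b := by
  have h := Real.sin_sq_add_cos_sq u
  have h1 := mul_nonneg ha.le (sq_nonneg (Real.sin u))
  have h2 := mul_nonneg hb.le (sq_nonneg (Real.cos u))
  have : a + b = a * (Real.sin u ^ 2 + Real.cos u ^ 2) + b * (Real.sin u ^ 2 + Real.cos u ^ 2) := by
    rw [h]; ring
  rw [this]; unfold mix; linarith

lemma radicand_le (hK₂ : 0 < K₂) (hK₃ : 0 < K₃) (u : ℝ) : radicand K₂ K₃ t C u ≤ C := by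
  rw [radicand_eq, sub_le_self_iff]
  have := mix_pos hK₂ hK₃ u
  positivity

lemma integrand_ge (hK₂ : 0 < K₂) (hK₃ : 0 < K₃) (hC : K₂ * t ^ 2 < C) (u : ℝ) :
    √(min K₁ K₃) / √C ≤ integrand K₁ K₂ K₃ t C u := by
  rw [integrand_eq]
  exact div_le_div₀ (Real.sqrt_nonneg _) (Real.sqrt_le_sqrt (min_le_mix _ _ _))
    (Real.sqrt_pos.2 (radicand_pos hK₂ hK₃ hC u)) (Real.sqrt_le_sqrt (radicand_le hK₂ hK₃ u))

lemma radicand_sub_eq (hK₂ : 0 < K₂) (hK₃ : 0 < K₃) (u : ℝ) :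
    radicand K₂ K₃ t C u =
      (C - K₂ * t ^ 2) + K₂ * t ^ 2 * K₃ * Real.sin u ^ 2 / mix K₂ K₃ u := by
  have h := (mix_pos hK₂ hK₃ u).ne'
  rw [radicand_eq]
  field_simp
  rw [mix]; ring

/-- The radicand exceeds its value `C - K₂ t²` at `u = 0` by at most a quadratic term. Hence the
integrand is bounded below by a multiple of `1 / (√(C - K₂ t²) + β u)`, the source of the
logarithmic divergence. -/
lemma exists_radicand_le (hK₂ : 0 < K₂) (hK₃ : 0 < K₃) (t : ℝ) :
    ∃ β > 0, ∀ C u, radicand K₂ K₃ t C u ≤ (C - K₂ * t ^ 2) + (β * u) ^ 2 := by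
  have hm : 0 < min K₂ K₃ := lt_min hK₂ hK₃
  have hq : 0 ≤ K₂ * t ^ 2 * K₃ / min K₂ K₃ := by positivity
  -- The summand `1` keeps `β` positive when `t = 0`.
  refine ⟨√(K₂ * t ^ 2 * K₃ / min K₂ K₃ + 1), Real.sqrt_pos.2 (by linarith), fun C u => ?_⟩
  rw [radicand_sub_eq hK₂ hK₃, mul_pow, Real.sq_sqrt (by linarith)]
  have h1 : K₂ * t ^ 2 * K₃ * Real.sin u ^ 2 / mix K₂ K₃ u ≤
      K₂ * t ^ 2 * K₃ * u ^ 2 / min K₂ K₃ := by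
    refine div_le_div₀ (by positivity) ?_ hm (min_le_mix _ _ _)
    exact mul_le_mul_of_nonneg_left (Real.sin_sq_le_sq) (by positivity)
  have h2 : K₂ * t ^ 2 * K₃ * u ^ 2 / min K₂ K₃ = K₂ * t ^ 2 * K₃ / min K₂ K₃ * u ^ 2 := by ring
  nlinarith [sq_nonneg u]

/-! ### The normalising constant -/

lemma integral_integrand_strictAnti (hK₁ : 0 < K₁) (hK₂ : 0 < K₂) (hK₃ : 0 < K₃) {C C' : ℝ}
    (hC : K₂ * t ^ 2 < C) (hCC : C < C') :
    ∫ u in (0 : ℝ)..(Real.pi / 2), integrand K₁ K₂ K₃ t C' u <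
      ∫ u in (0 : ℝ)..(Real.pi / 2), integrand K₁ K₂ K₃ t C u := by
  have hlt : ∀ u, integrand K₁ K₂ K₃ t C' u < integrand K₁ K₂ K₃ t C u := fun u => by
    rw [integrand_eq, integrand_eq]
    have hR := radicand_pos hK₂ hK₃ hC u
    refine div_lt_div_of_pos_left (Real.sqrt_pos.2 (mix_pos hK₁ hK₃ u)) (Real.sqrt_pos.2 hR)
      (Real.sqrt_lt_sqrt hR.le ?_)
    rw [radicand_eq, radicand_eq]; linarith
  exact intervalIntegral.integral_lt_integral_of_continuousOn_of_le_of_exists_lt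
    (by positivity) (continuous_integrand hK₂ hK₃ (hC.trans hCC)).continuousOn
    (continuous_integrand hK₂ hK₃ hC).continuousOn (fun u _ => (hlt u).le)
    ⟨0, left_mem_Icc.2 (by positivity), hlt 0⟩

/-- Letting `u → 0` in the positivity condition gives `K₂ t² ≤ C`. Equality would bound the
integrand below by a multiple of `1 / u`, which is not integrable at `0`. -/
lemma IsNormalising.lt (hK₁ : 0 < K₁) (hK₂ : 0 < K₂) (hK₃ : 0 < K₃)
    (h : IsNormalising K₁ K₂ K₃ t C) : K₂ * t ^ 2 < C := by
  have hpi : 0 < Real.pi / 2 := by positivity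
  have hle : K₂ * t ^ 2 ≤ C := by
    have hcont := (continuous_radicand hK₂ hK₃ t C).tendsto 0
    have h0 : 0 ≤ radicand K₂ K₃ t C 0 := by
      refine ge_of_tendsto (hcont.mono_left nhdsWithin_le_nhds : Filter.Tendsto _
        (nhdsWithin (0 : ℝ) (Ioi 0)) _) ?_
      filter_upwards [Ioc_mem_nhdsGT hpi] with u hu using (h.1 u hu).le
    rw [radicand_sub_eq hK₂ hK₃] at h0
    simpa using h0
  refine hle.lt_of_ne fun heq => ?_
  obtain ⟨β, hβ, hb⟩ := exists_radicand_le hK₂ hK₃ t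
  have hm : 0 < √(min K₁ K₃) := Real.sqrt_pos.2 (lt_min hK₁ hK₃)
  have hge : ∀ u ∈ Ioc 0 (Real.pi / 2), u⁻¹ ≤ β / √(min K₁ K₃) * integrand K₁ K₂ K₃ t C u := by
    intro u hu
    have hR : √(radicand K₂ K₃ t C u) ≤ β * u := by
      rw [Real.sqrt_le_left (mul_nonneg hβ.le hu.1.le)]
      have := hb C u
      rwa [← heq, sub_self, zero_add, heq] at this
    have h1 : √(min K₁ K₃) / (β * u) ≤ integrand K₁ K₂ K₃ t C u := by
      rw [integrand_eq]
      exact div_le_div₀ (Real.sqrt_nonneg _) (Real.sqrt_le_sqrt (min_le_mix _ _ _))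
        (Real.sqrt_pos.2 (h.1 u hu)) hR
    calc u⁻¹ = β / √(min K₁ K₃) * (√(min K₁ K₃) / (β * u)) := by
          have := hu.1.ne'
          field_simp
      _ ≤ _ := by gcongr
  have hint : IntervalIntegrable (fun u : ℝ => u⁻¹) volume 0 (Real.pi / 2) := by
    refine (h.2.1.const_mul (β / √(min K₁ K₃))).mono_fun' measurable_inv.aestronglyMeasurable ?_
    rw [uIoc_of_le hpi.le]
    filter_upwards [ae_restrict_mem measurableSet_Ioc] with u hu
    rw [Real.norm_eq_abs, abs_of_pos (inv_pos.2 hu.1)]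
    exact hge u hu
  rw [intervalIntegrable_inv_iff] at hint
  rcases hint with h' | h'
  · exact hpi.ne h'
  · exact h' left_mem_uIcc

/-- Writing `C = K₂ t² + exp s` turns the admissible range into the whole line, where the
intermediate value theorem applies. -/
lemma exists_isNormalising (hK₁ : 0 < K₁) (hK₂ : 0 < K₂) (hK₃ : 0 < K₃) (t : ℝ) :
    ∃ C, IsNormalising K₁ K₂ K₃ t C := by
  have hpi := Real.pi_pos
  have hgt : ∀ s, K₂ * t ^ 2 < K₂ * t ^ 2 + Real.exp s := fun s => by
    linarith [Real.exp_pos s]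
  set J : ℝ → ℝ := fun s =>
    ∫ u in (0 : ℝ)..(Real.pi / 2), integrand K₁ K₂ K₃ t (K₂ * t ^ 2 + Real.exp s) u with hJ
  have hJc : Continuous J := by
    refine intervalIntegral.continuous_parametric_intervalIntegral_of_continuous' ?_ _ _
    simp only [Function.uncurry_def, integrand_eq]
    refine Continuous.div ((continuous_mix _ _).comp continuous_snd).sqrt
      (Continuous.sqrt ?_) fun p =>
        (Real.sqrt_pos.2 (radicand_pos hK₂ hK₃ (hgt p.1) p.2)).ne'
    have e : ∀ p : ℝ × ℝ, radicand K₂ K₃ t (K₂ * t ^ 2 + Real.exp p.1) p.2 =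
        Real.exp p.1 + radicand K₂ K₃ t (K₂ * t ^ 2) p.2 := fun p => by
      rw [radicand_eq, radicand_eq]; ring
    simp only [e]
    exact (Real.continuous_exp.comp continuous_fst).add
      ((continuous_radicand hK₂ hK₃ t _).comp continuous_snd)
  have hint : ∀ s a b, IntervalIntegrable
      (integrand K₁ K₂ K₃ t (K₂ * t ^ 2 + Real.exp s)) volume a b := fun s a b =>
    (continuous_integrand hK₂ hK₃ (hgt s)).intervalIntegrable a b
  have hsmall : ∃ s, J s ≤ 1 := by
    -- This value of `C - K₂ t²` bounds the integrand by `2 / π` on an interval of length `π / 2`.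
    refine ⟨Real.log ((Real.pi / 2) ^ 2 * (K₁ + K₃)), ?_⟩
    have hle : ∀ u, integrand K₁ K₂ K₃ t
        (K₂ * t ^ 2 + Real.exp (Real.log ((Real.pi / 2) ^ 2 * (K₁ + K₃)))) u ≤ 2 / Real.pi := by
      intro u
      rw [integrand_eq, Real.exp_log (by positivity), radicand_sub_eq hK₂ hK₃]
      have h1 : 0 ≤ K₂ * t ^ 2 * K₃ * Real.sin u ^ 2 / mix K₂ K₃ u := by
        have := mix_pos hK₂ hK₃ u
        positivity
      have h2 : √((Real.pi / 2) ^ 2 * (K₁ + K₃)) = Real.pi / 2 * √(K₁ + K₃) := by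
        rw [Real.sqrt_mul (by positivity), Real.sqrt_sq (by positivity)]
      have h3 : 0 < √(K₁ + K₃) := Real.sqrt_pos.2 (by linarith)
      calc _ ≤ √(K₁ + K₃) / √((Real.pi / 2) ^ 2 * (K₁ + K₃)) := by
            refine div_le_div₀ (Real.sqrt_nonneg _) (Real.sqrt_le_sqrt (mix_le_add hK₁ hK₃ u))
              (by rw [h2]; positivity) (Real.sqrt_le_sqrt (by linarith))
        _ = 2 / Real.pi := by rw [h2]; field_simp
    calc J _ ≤ ∫ _ in (0 : ℝ)..(Real.pi / 2), 2 / Real.pi :=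
          intervalIntegral.integral_mono_on (by positivity) (hint _ _ _)
            intervalIntegrable_const fun u _ => hle u
      _ = 1 := by rw [intervalIntegral.integral_const, smul_eq_mul]; field_simp; ring
  have hlarge : ∃ s, 1 ≤ J s := by
    obtain ⟨β, hβ, hb⟩ := exists_radicand_le hK₂ hK₃ t
    set m := √(min K₁ K₃) with hmdef
    have hm : 0 < m := Real.sqrt_pos.2 (lt_min hK₁ hK₃)
    -- Chosen so that `(m / β) * log (β (π / 2) / ε) = 1`. With `C - K₂ t² = ε²` the root of the
    -- radicand is at most `ε + β u`, and the integral of `m / (ε + β u)` is then at least `1`.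
    set ε := β * (Real.pi / 2) * Real.exp (-(β / m)) with hε
    have hε0 : 0 < ε := by positivity
    refine ⟨Real.log (ε ^ 2), ?_⟩
    have hge : ∀ u ∈ Icc 0 (Real.pi / 2), m / (ε + β * u) ≤
        integrand K₁ K₂ K₃ t (K₂ * t ^ 2 + Real.exp (Real.log (ε ^ 2))) u := by
      intro u hu
      have hβu : 0 ≤ β * u := mul_nonneg hβ.le hu.1
      rw [integrand_eq]
      refine div_le_div₀ (Real.sqrt_nonneg _) (Real.sqrt_le_sqrt (min_le_mix _ _ _))
        (Real.sqrt_pos.2 (radicand_pos hK₂ hK₃ (hgt _) u)) ?_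
      rw [Real.sqrt_le_left (by positivity)]
      refine (hb _ u).trans ?_
      rw [Real.exp_log (by positivity)]
      nlinarith [mul_nonneg hε0.le hβu]
    have hd : ∀ u ∈ uIcc 0 (Real.pi / 2),
        HasDerivAt (fun u => m / β * Real.log (ε + β * u)) (m / (ε + β * u)) u := by
      intro u hu
      rw [uIcc_of_le (by positivity)] at hu
      have hpos : 0 < ε + β * u := by linarith [mul_nonneg hβ.le hu.1]
      have := ((((hasDerivAt_id' u).const_mul β).const_add ε).log hpos.ne').const_mul (m / β)
      refine this.congr_deriv ?_
      field_simp
    have hci : IntervalIntegrable (fun u => m / (ε + β * u)) volume 0 (Real.pi / 2) := by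
      refine ContinuousOn.intervalIntegrable (continuousOn_const.div (by fun_prop) ?_)
      intro u hu
      rw [uIcc_of_le (by positivity)] at hu
      linarith [mul_nonneg hβ.le hu.1]
    calc 1 = m / β * (β / m) := by field_simp
      _ ≤ m / β * (Real.log (ε + β * (Real.pi / 2)) - Real.log ε) := by
          gcongr
          have h1 : Real.log ε = Real.log (β * (Real.pi / 2)) - β / m := by
            rw [hε, Real.log_mul (by positivity) (by positivity), Real.log_exp]; ring
          have h2 : Real.log (β * (Real.pi / 2)) ≤ Real.log (ε + β * (Real.pi / 2)) :=
            Real.log_le_log (by positivity) (by linarith)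
          linarith
      _ = ∫ u in (0 : ℝ)..(Real.pi / 2), m / (ε + β * u) := by
          rw [intervalIntegral.integral_eq_sub_of_hasDerivAt hd hci]; simp [mul_sub]
      _ ≤ J _ := intervalIntegral.integral_mono_on (by positivity) hci (hint _ _ _) hge
  obtain ⟨s₁, h1⟩ := hsmall
  obtain ⟨s₂, h2⟩ := hlarge
  obtain ⟨s, hs⟩ := mem_range_of_exists_le_of_exists_ge hJc ⟨s₁, h1⟩ ⟨s₂, h2⟩
  exact ⟨_, fun u _ => radicand_pos hK₂ hK₃ (hgt s) u, hint s _ _, hs⟩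

lemma existsUnique_isNormalising (hK₁ : 0 < K₁) (hK₂ : 0 < K₂) (hK₃ : 0 < K₃) (t : ℝ) :
    ∃! C, IsNormalising K₁ K₂ K₃ t C := by
  obtain ⟨C, hC⟩ := exists_isNormalising hK₁ hK₂ hK₃ t
  refine ⟨C, hC, fun C' hC' => ?_⟩
  have h := hC.lt hK₁ hK₂ hK₃
  have h' := hC'.lt hK₁ hK₂ hK₃
  rcases lt_trichotomy C' C with hlt | heq | hlt
  · have := integral_integrand_strictAnti hK₁ hK₂ hK₃ h' hlt
    rw [hC.2.2, hC'.2.2] at this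
    exact absurd this (lt_irrefl _)
  · exact heq
  · have := integral_integrand_strictAnti hK₁ hK₂ hK₃ h hlt
    rw [hC.2.2, hC'.2.2] at this
    exact absurd this (lt_irrefl _)

/-! ### The angle functions -/

lemma strictMono_integral_integrand (hK₁ : 0 < K₁) (hK₂ : 0 < K₂) (hK₃ : 0 < K₃)
    (hC : K₂ * t ^ 2 < C) :
    StrictMono fun x => ∫ u in (0 : ℝ)..x, integrand K₁ K₂ K₃ t C u := by
  refine strictMono_of_deriv_pos fun x => ?_
  rw [(hasDerivAt_primitive (continuous_integrand hK₂ hK₃ hC) 0 x).deriv]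
  exact integrand_pos hK₁ hK₂ hK₃ hC x

/-- The integrand has a positive lower bound, so its primitive grows at least linearly in both
directions. -/
lemma surjective_integral_integrand (hK₁ : 0 < K₁) (hK₂ : 0 < K₂) (hK₃ : 0 < K₃)
    (hC : K₂ * t ^ 2 < C) :
    Function.Surjective fun x => ∫ u in (0 : ℝ)..x, integrand K₁ K₂ K₃ t C u := by
  have hC0 : 0 < C := lt_of_le_of_lt (by positivity) hC
  set m := √(min K₁ K₃) / √C with hm
  have hm0 : 0 < m := div_pos (Real.sqrt_pos.2 (lt_min hK₁ hK₃)) (Real.sqrt_pos.2 hC0)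
  have hcont := continuous_integrand (K₁ := K₁) hK₂ hK₃ hC
  have hmono : Monotone fun x => (∫ u in (0 : ℝ)..x, integrand K₁ K₂ K₃ t C u) - m * x := by
    have hd : ∀ x, HasDerivAt
        (fun x => (∫ u in (0 : ℝ)..x, integrand K₁ K₂ K₃ t C u) - m * x)
        (integrand K₁ K₂ K₃ t C x - m) x := fun x => by
      have := (hasDerivAt_primitive hcont 0 x).fun_sub ((hasDerivAt_id' x).const_mul m)
      rwa [mul_one] at this
    refine monotone_of_deriv_nonneg (fun x => (hd x).differentiableAt) fun x => ?_
    rw [(hd x).deriv, sub_nonneg]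
    exact integrand_ge hK₂ hK₃ hC x
  refine (contDiff_one_primitive hcont 0).continuous.surjective ?_ ?_
  · refine Filter.tendsto_atTop_mono' _ ?_ (Filter.tendsto_id.const_mul_atTop hm0)
    filter_upwards [Filter.eventually_ge_atTop 0] with x hx
    have := hmono hx
    simp at this ⊢; linarith
  · refine Filter.tendsto_atBot_mono' _ ?_ (Filter.tendsto_id.const_mul_atBot hm0)
    filter_upwards [Filter.eventually_le_atBot 0] with x hx
    have := hmono hx
    simp at this ⊢; linarith

/-- `θ` is the inverse of the primitive of the integrand. It is taken on all of `ℝ`, so that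
two-sided derivatives exist at `0` and `1`; normalisation of `C` is what gives `θ 1 = π / 2`. -/
lemma exists_theta (hK₁ : 0 < K₁) (hK₂ : 0 < K₂) (hK₃ : 0 < K₃)
    (h : IsNormalising K₁ K₂ K₃ t C) :
    ∃ θ : ℝ → ℝ, IsTheta K₁ K₂ K₃ t C θ ∧ StrictMono θ ∧ θ 0 = 0 ∧
      ∀ z, HasDerivAt θ (integrand K₁ K₂ K₃ t C (θ z))⁻¹ z := by
  have hC := h.lt hK₁ hK₂ hK₃
  have hcont := continuous_integrand (K₁ := K₁) hK₂ hK₃ hC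
  have hmono := strictMono_integral_integrand hK₁ hK₂ hK₃ hC
  set e := hmono.orderIsoOfSurjective _ (surjective_integral_integrand hK₁ hK₂ hK₃ hC) with he
  have hinv : ∀ z, ∫ u in (0 : ℝ)..(e.symm z), integrand K₁ K₂ K₃ t C u = z := fun z =>
    e.apply_symm_apply z
  have hinv' : ∀ x z, (∫ u in (0 : ℝ)..x, integrand K₁ K₂ K₃ t C u) = z → e.symm z = x :=
    fun x z hx => hmono.injective ((hinv z).trans hx.symm)
  refine ⟨e.symm, ⟨fun z _ => ⟨hcont.intervalIntegrable _ _, hinv z⟩, hinv' _ _ h.2.2⟩,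
    e.symm.strictMono, hinv' _ _ intervalIntegral.integral_same, fun z => ?_⟩
  exact HasDerivAt.of_local_left_inverse e.symm.continuous.continuousAt
    (hasDerivAt_primitive hcont 0 _) (integrand_pos hK₁ hK₂ hK₃ hC _).ne'
    (Filter.Eventually.of_forall hinv)

lemma eqOn_of_integral_integrand_eq (hK₁ : 0 < K₁) (hK₂ : 0 < K₂) (hK₃ : 0 < K₃) (hC : K₂ * t ^ 2 < C)
    {θ θ' : ℝ → ℝ} (hθ : ∀ z ∈ Icc (0 : ℝ) 1, ∫ u in (0 : ℝ)..(θ z), integrand K₁ K₂ K₃ t C u = z)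
    (hθ' : ∀ z ∈ Icc (0 : ℝ) 1, ∫ u in (0 : ℝ)..(θ' z), integrand K₁ K₂ K₃ t C u = z) :
    EqOn θ' θ (Icc 0 1) := fun z hz =>
  (strictMono_integral_integrand hK₁ hK₂ hK₃ hC).injective ((hθ' z hz).trans (hθ z hz).symm)

lemma IsPhi.eqOn {θ φ φ' : ℝ → ℝ} (h : IsPhi K₂ K₃ t θ φ) (h' : IsPhi K₂ K₃ t θ φ') :
    EqOn φ' φ (Icc 0 1) := by
  intro z hz
  have := constant_of_has_deriv_right_zero (f := fun z => φ' z - φ z) (a := 0) (b := 1)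
    ((HasDerivWithinAt.continuousOn h'.1).sub (HasDerivWithinAt.continuousOn h.1)) (fun z hz => by
      have := ((h'.1 z (Ico_subset_Icc_self hz)).sub (h.1 z (Ico_subset_Icc_self hz)))
      rw [sub_self] at this
      exact this.mono_of_mem_nhdsWithin (Icc_mem_nhdsGE_of_mem hz)) z hz
  rw [h.2, h'.2, sub_self] at this
  exact sub_eq_zero.1 this

lemma exists_phi (hK₂ : 0 < K₂) (hK₃ : 0 < K₃) (t : ℝ) {θ : ℝ → ℝ} (hθ : Continuous θ) :
    ∃ φ : ℝ → ℝ, IsPhi K₂ K₃ t θ φ ∧ φ 0 = 0 ∧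
      ∀ z, HasDerivAt φ (K₂ * t / mix K₂ K₃ (θ z)) z := by
  have hcont : Continuous fun z => K₂ * t / mix K₂ K₃ (θ z) :=
    continuous_const.div ((continuous_mix _ _).comp hθ) fun z => (mix_pos hK₂ hK₃ _).ne'
  exact ⟨fun z => ∫ s in (0 : ℝ)..z, K₂ * t / mix K₂ K₃ (θ s),
    ⟨fun z _ => (hasDerivAt_primitive hcont 0 z).hasDerivWithinAt,
      intervalIntegral.integral_same⟩, intervalIntegral.integral_same,
    fun z => hasDerivAt_primitive hcont 0 z⟩

end

section

variable {K₁ K₂ K₃ K₄ t C L₁ L₂ : ℝ} {N : ℝ → Vec3}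

/-! ### The energy of a profile -/

/-- The derivative of a curve, componentwise. -/
def velocity (N : ℝ → Vec3) (z : ℝ) : Vec3 := fun i => deriv (fun z => N z i) z

lemma IsProfile.memLp_mul (hN : IsProfile N)
    (hD : ∀ i, MemLp (deriv fun z => N z i) 2 (volume.restrict (Ioo (0 : ℝ) 1))) (i j : Fin 3) :
    MemLp (fun z => N z i * velocity N z j) 2 (volume.restrict (Ioo (0 : ℝ) 1)) := by
  obtain ⟨B, hB⟩ := hN.exists_bound
  have hb : MemLp (fun z => N z i) ⊤ (volume.restrict (Ioo (0 : ℝ) 1)) := by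
    refine MemLp.of_bound (hN.aestronglyMeasurable i) B ?_
    filter_upwards [ae_restrict_mem measurableSet_Ioo] with z hz
    exact hB i z (Ioo_subset_Icc_self hz)
  exact (hD j).mul' hb

lemma IsProfile.integrableOn_density (hN : IsProfile N)
    (hD : ∀ i, MemLp (deriv fun z => N z i) 2 (volume.restrict (Ioo (0 : ℝ) 1))) :
    IntegrableOn (fun z => density K₁ K₂ K₃ K₄ t (N z) (zGrad (velocity N z))) (Ioo 0 1) := by
  simp only [density_zGrad]
  have hm := hN.memLp_mul hD
  have hc : MemLp (fun _ : ℝ => t) 2 (volume.restrict (Ioo (0 : ℝ) 1)) := memLp_const t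
  exact (((hD 2).integrable_sq.const_mul K₁).add
    ((hc.sub ((hm 0 1).sub (hm 1 0))).integrable_sq.const_mul K₂)).add
    ((((hm 2 0).integrable_sq.add (hm 2 1).integrable_sq).add
      ((hm 0 0).add (hm 1 1)).integrable_sq).const_mul K₃)

lemma IsProfile.energy_eq (hL₁ : 0 < L₁) (hL₂ : 0 < L₂) (hN : IsProfile N)
    (hD : ∀ i, MemLp (deriv fun z => N z i) 2 (volume.restrict (Ioo (0 : ℝ) 1)))
    {n : Vec3 → Vec3} (hn : ∀ᵐ x ∂volume.restrict (cuboid L₁ L₂), n x = N (x 2)) :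
    energy K₁ K₂ K₃ K₄ t L₁ L₂ n = (volume (face L₁ L₂ 2)).toReal *
      ∫ z in Ioo (0 : ℝ) 1, density K₁ K₂ K₃ K₄ t (N z) (zGrad (velocity N z)) := by
  rw [← setIntegral_comp_height (hN.integrableOn_density hD).1, energy]
  refine integral_congr_ae ?_
  filter_upwards [hn, hN.weakGrad_ae_eq hL₁ hL₂ hn] with x hx hx'
  rw [hx, hx']
  rfl

/-- The calibration: the energy of a profile with latitude `θ` is a boundary term plus the integral
of the excess. -/
lemma IsProfile.integral_density (hK₂ : 0 < K₂) (hK₃ : 0 < K₃) (hN : IsProfile N)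
    (hD : ∀ i, MemLp (deriv fun z => N z i) 2 (volume.restrict (Ioo (0 : ℝ) 1)))
    {θ : ℝ → ℝ} (hθ : AbsolutelyContinuousOnInterval θ 0 1) :
    IntegrableOn (fun z => excess K₁ K₂ K₃ K₄ t C (N z) (velocity N z) (θ z) (deriv θ z))
      (Ioo 0 1) ∧
    ∫ z in Ioo (0 : ℝ) 1, density K₁ K₂ K₃ K₄ t (N z) (zGrad (velocity N z)) =
      (K₂ * t ^ 2 - C) +
      ((∫ u in (0 : ℝ)..(θ 1), 2 * (√(mix K₁ K₃ u) * √(radicand K₂ K₃ t C u))) -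
        ∫ u in (0 : ℝ)..(θ 0), 2 * (√(mix K₁ K₃ u) * √(radicand K₂ K₃ t C u))) +
      ∫ z in Ioo (0 : ℝ) 1,
        excess K₁ K₂ K₃ K₄ t C (N z) (velocity N z) (θ z) (deriv θ z) := by
  have hf : Continuous fun u => 2 * (√(mix K₁ K₃ u) * √(radicand K₂ K₃ t C u)) :=
    continuous_const.mul ((continuous_mix _ _).sqrt.mul (continuous_radicand hK₂ hK₃ t C).sqrt)
  -- The calibration term is the derivative of a `C¹` function of the latitude, so the fundamental
  -- theorem of calculus leaves only end values.
  have hac := absolutelyContinuousOnInterval_comp (contDiff_one_primitive hf 0) hθ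
  have hint : IntegrableOn (fun z => 2 * (√(mix K₁ K₃ (θ z)) * √(radicand K₂ K₃ t C (θ z))) *
      deriv θ z) (Ioo 0 1) := by
    rw [← intervalIntegrable_iff_integrableOn_Ioo_of_le zero_le_one]
    exact hθ.intervalIntegrable_deriv.continuousOn_mul (hf.comp_continuousOn hθ.continuousOn)
  have hval := hac.integral_deriv_eq_sub
  have hcongr : ∫ z in (0 : ℝ)..1, deriv (fun z => ∫ u in (0 : ℝ)..(θ z),
      2 * (√(mix K₁ K₃ u) * √(radicand K₂ K₃ t C u))) z =
      ∫ z in (0 : ℝ)..1, 2 * (√(mix K₁ K₃ (θ z)) * √(radicand K₂ K₃ t C (θ z))) * deriv θ z := by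
    refine intervalIntegral.integral_congr_ae ?_
    filter_upwards [hθ.ae_differentiableAt] with z hz hz'
    exact ((hasDerivAt_primitive hf 0 (θ z)).comp z (hz (uIoc_subset_uIcc hz')).hasDerivAt).deriv
  rw [hcongr, intervalIntegral.integral_of_le zero_le_one, integral_Ioc_eq_integral_Ioo] at hval
  have hW := hN.integrableOn_density (K₁ := K₁) (K₂ := K₂) (K₃ := K₃) (K₄ := K₄) (t := t) hD
  have hc : IntegrableOn (fun _ : ℝ => K₂ * t ^ 2 - C) (Ioo (0 : ℝ) 1) := by simp
  refine ⟨(hW.sub hc).sub hint, ?_⟩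
  have hsplit := (integral_sub (hW.sub hc) hint).trans
    (congrArg (· - _) (integral_sub hW hc))
  simp only [Pi.sub_apply] at hsplit
  simp only [excess]
  rw [hsplit, hval]
  simp

/-! ### The latitude of a profile on the sphere -/

/-- Supplies the pointwise hypotheses of `excess_eq` and of its counterpart at the poles. At a pole
the latitude attains an extreme value of `arcsin`, so its derivative is zero there. -/
lemma IsProfile.ae_latitude (hN : IsProfile N) (h1 : ∀ z ∈ Icc (0 : ℝ) 1, N z ⬝ᵥ N z = 1) :
    ∀ᵐ z ∂volume.restrict (Ioo (0 : ℝ) 1),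
      (∀ i, HasDerivAt (fun z => N z i) (velocity N z i) z) ∧
      HasDerivAt (fun z => Real.arcsin (N z 2)) (deriv (fun z => Real.arcsin (N z 2)) z) z ∧
      N z ⬝ᵥ velocity N z = 0 ∧ N z 2 = Real.sin (Real.arcsin (N z 2)) ∧
      velocity N z 2 = Real.cos (Real.arcsin (N z 2)) *
        deriv (fun z => Real.arcsin (N z 2)) z ∧
      (Real.cos (Real.arcsin (N z 2)) = 0 → deriv (fun z => Real.arcsin (N z 2)) z = 0) := by
  have hsin : ∀ z ∈ Icc (0 : ℝ) 1, Real.sin (Real.arcsin (N z 2)) = N z 2 := by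
    intro z hz
    have := h1 z hz
    rw [dotProduct_eq] at this
    exact Real.sin_arcsin (by nlinarith [sq_nonneg (N z 0), sq_nonneg (N z 1)])
      (by nlinarith [sq_nonneg (N z 0), sq_nonneg (N z 1)])
  rw [ae_restrict_iff' measurableSet_Ioo]
  filter_upwards [ae_all_iff.2 fun i => (hN i).ae_differentiableAt,
    (hN.absolutelyContinuous_arcsin h1).ae_differentiableAt] with z hz hz' hzI
  rw [uIcc_of_le zero_le_one] at hz hz'
  have hzc := Ioo_subset_Icc_self hzI
  have hnhds : Icc (0 : ℝ) 1 ∈ nhds z := Icc_mem_nhds hzI.1 hzI.2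
  have hd : ∀ i, HasDerivAt (fun z => N z i) (velocity N z i) z := fun i => (hz i hzc).hasDerivAt
  have hθ := (hz' hzc).hasDerivAt
  refine ⟨hd, hθ, ?_, (hsin z hzc).symm, ?_, fun hcos => ?_⟩
  · have hsq := (((hd 0).fun_mul (hd 0)).fun_add ((hd 1).fun_mul (hd 1))).fun_add
      ((hd 2).fun_mul (hd 2))
    have hconst : (fun z => N z 0 * N z 0 + N z 1 * N z 1 + N z 2 * N z 2) =ᶠ[nhds z]
        fun _ => 1 := by
      filter_upwards [hnhds] with y hy
      rw [← dotProduct_eq, h1 y hy]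
    have := (hsq.congr_of_eventuallyEq hconst.symm).unique (hasDerivAt_const z (1 : ℝ))
    rw [dotProduct_eq]
    linarith
  · have hs : (fun z => N z 2) =ᶠ[nhds z] fun z => Real.sin (Real.arcsin (N z 2)) := by
      filter_upwards [hnhds] with y hy using (hsin y hy).symm
    exact (hd 2).unique (hθ.sin.congr_of_eventuallyEq hs)
  · rcases (Real.arcsin_le_pi_div_two (N z 2)).eq_or_lt with h | h
    · have : IsLocalMax (fun z => Real.arcsin (N z 2)) z :=
        Filter.Eventually.of_forall fun y => by
          simp only; rw [h]; exact Real.arcsin_le_pi_div_two _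
      exact this.deriv_eq_zero
    rcases (Real.neg_pi_div_two_le_arcsin (N z 2)).eq_or_lt with h' | h'
    · have : IsLocalMin (fun z => Real.arcsin (N z 2)) z :=
        Filter.Eventually.of_forall fun y => by
          simp only; rw [← h']; exact Real.neg_pi_div_two_le_arcsin _
      exact this.deriv_eq_zero
    · exact absurd hcos (Real.cos_pos_of_mem_Ioo ⟨h', h⟩).ne'

lemma IsProfile.ae_excess_nonneg (hK₁ : 0 < K₁) (hK₂ : 0 < K₂) (hK₃ : 0 < K₃)
    (hC : K₂ * t ^ 2 < C) (hN : IsProfile N) (h1 : ∀ z ∈ Icc (0 : ℝ) 1, N z ⬝ᵥ N z = 1) :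
    ∀ᵐ z ∂volume.restrict (Ioo (0 : ℝ) 1), 0 ≤ excess K₁ K₂ K₃ K₄ t C (N z) (velocity N z)
      (Real.arcsin (N z 2)) (deriv (fun z => Real.arcsin (N z 2)) z) := by
  filter_upwards [hN.ae_latitude h1, ae_restrict_mem measurableSet_Ioo] with z hz hzI
  obtain ⟨-, -, h0, hs, hτ, hz0⟩ := hz
  by_cases hc : Real.cos (Real.arcsin (N z 2)) = 0
  · rw [hz0 hc]
    exact (excess_of_cos_eq_zero hK₂ hK₃ hK₁ hC (h1 z (Ioo_subset_Icc_self hzI)) hs hc).le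
  · rw [excess_eq hK₁ hK₂ hK₃ hC (h1 z (Ioo_subset_Icc_self hzI)) h0 hs hτ hc]
    have := mix_pos hK₂ hK₃ (Real.arcsin (N z 2))
    positivity

/-! ### The equality case -/

/-- The curve on the sphere with Euler angles `θ`, `φ`. -/
def euler (θ φ : ℝ → ℝ) (z : ℝ) : Vec3 :=
  ![Real.cos (φ z) * Real.cos (θ z), Real.sin (φ z) * Real.cos (θ z), Real.sin (θ z)]

lemma excess_eq_zero (hK₁ : 0 < K₁) (hK₂ : 0 < K₂) (hK₃ : 0 < K₃)
    (hC : K₂ * t ^ 2 < C) {n d : Vec3} {u τ : ℝ} (h1 : n ⬝ᵥ n = 1) (h0 : n ⬝ᵥ d = 0)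
    (hu : n 2 = Real.sin u) (hτ : d 2 = Real.cos u * τ) (hc : Real.cos u = 0 → τ = 0)
    (he : excess K₁ K₂ K₃ K₄ t C n d u τ = 0) :
    τ = (integrand K₁ K₂ K₃ t C u)⁻¹ ∧
      n 0 * d 1 - n 1 * d 0 = Real.cos u ^ 2 * (K₂ * t / mix K₂ K₃ u) := by
  have hcu : Real.cos u ≠ 0 := fun h => by
    rw [hc h] at he
    exact (excess_of_cos_eq_zero hK₂ hK₃ hK₁ hC h1 hu h).ne' he
  rw [excess_eq hK₁ hK₂ hK₃ hC h1 h0 hu hτ hcu] at he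
  have hB := mix_pos hK₂ hK₃ u
  have hA := Real.sqrt_pos.2 (mix_pos hK₁ hK₃ u)
  have hc2 : 0 < Real.cos u ^ 2 := by positivity
  obtain ⟨e1, e2⟩ := (add_eq_zero_iff_of_nonneg (sq_nonneg _) (by positivity)).1 he
  have e1' := sub_eq_zero.1 (pow_eq_zero_iff two_ne_zero |>.1 e1)
  have e2' := sub_eq_zero.1 (pow_eq_zero_iff two_ne_zero |>.1
    ((mul_eq_zero.1 e2).resolve_left (mul_pos hc2 hB).ne'))
  constructor
  · rw [integrand_eq, inv_div, eq_div_iff hA.ne', ← e1', mul_comm]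
  · rw [← e2']; field_simp

/-- Zero excess gives first-order equations almost everywhere. Each is integrated by exhibiting an
absolutely continuous quantity with zero derivative almost everywhere, so no uniqueness theorem for
differential equations is needed. -/
lemma eqOn_euler (hK₁ : 0 < K₁) (hK₂ : 0 < K₂) (hK₃ : 0 < K₃) (hC : K₂ * t ^ 2 < C)
    {θ φ : ℝ → ℝ} (hθ : IsTheta K₁ K₂ K₃ t C θ) (hmono : StrictMono θ) (hθ0 : θ 0 = 0)
    (hθd : ∀ z, HasDerivAt θ (integrand K₁ K₂ K₃ t C (θ z))⁻¹ z) (hφ0 : φ 0 = 0)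
    (hφd : ∀ z, HasDerivAt φ (K₂ * t / mix K₂ K₃ (θ z)) z)
    (hN : IsProfile N) (h1 : ∀ z ∈ Icc (0 : ℝ) 1, N z ⬝ᵥ N z = 1) (hN0 : N 0 = ![1, 0, 0])
    (he : ∀ᵐ z ∂volume.restrict (Ioo (0 : ℝ) 1), excess K₁ K₂ K₃ K₄ t C (N z) (velocity N z)
      (Real.arcsin (N z 2)) (deriv (fun z => Real.arcsin (N z 2)) z) = 0) :
    EqOn N (euler θ φ) (Ioo 0 1) := by
  have hcont := continuous_integrand (K₁ := K₁) hK₂ hK₃ hC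
  have hα := hN.absolutelyContinuous_arcsin h1
  have hae := hN.ae_latitude h1
  rw [ae_restrict_iff' measurableSet_Ioo] at hae he
  -- The constancy criterion quantifies over the closed interval, while the equations hold almost
  -- everywhere in the open one.
  have hne : ∀ᵐ z : ℝ, z ≠ 0 ∧ z ≠ 1 := by
    have h0 : ∀ᵐ z : ℝ, z ≠ 0 := by simp [ae_iff]
    have h1 : ∀ᵐ z : ℝ, z ≠ 1 := by simp [ae_iff]
    filter_upwards [h0, h1] with z h h' using ⟨h, h'⟩
  have hα0 : Real.arcsin (N 0 2) = 0 := by simp [hN0]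
  -- the latitude solves the implicit equation
  have hlat : EqOn (fun z => Real.arcsin (N z 2)) θ (Icc 0 1) := by
    refine eqOn_of_integral_integrand_eq hK₁ hK₂ hK₃ hC (fun z hz => (hθ.1 z hz).2) fun z hz => ?_
    -- The conserved quantity is the primitive of the integrand at the latitude, minus the height.
    have hac := (absolutelyContinuousOnInterval_comp
      (contDiff_one_primitive hcont 0) hα).fun_sub
      (ContDiffOn.absolutelyContinuousOnInterval (contDiff_id (𝕜 := ℝ) (E := ℝ)).contDiffOn)
    obtain ⟨c, hc⟩ := hac.const_of_ae_hasDerivAt_zero (by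
      filter_upwards [hae, he, hne] with y hy hy' hyne hyI
      rw [uIcc_of_le zero_le_one] at hyI
      have hyo : y ∈ Ioo (0 : ℝ) 1 := ⟨hyI.1.lt_of_ne' hyne.1, hyI.2.lt_of_ne hyne.2⟩
      obtain ⟨-, hd, h0, hs, hτ, hz0⟩ := hy hyo
      have hτ' := (excess_eq_zero hK₁ hK₂ hK₃ hC (h1 y hyI) h0 hs hτ hz0 (hy' hyo)).1
      have := ((hasDerivAt_primitive hcont 0 (Real.arcsin (N y 2))).comp y hd).fun_sub
        (hasDerivAt_id y)
      refine this.congr_deriv ?_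
      rw [hτ', mul_inv_cancel₀ (integrand_pos hK₁ hK₂ hK₃ hC _).ne', sub_self])
    rw [uIcc_of_le zero_le_one] at hc
    have e0 := hc 0 (left_mem_Icc.2 zero_le_one)
    have ez := hc z hz
    simp only [hα0, intervalIntegral.integral_same, id] at e0 ez
    linarith
  have hcosθ : ∀ z ∈ Ico (0 : ℝ) 1, 0 < Real.cos (θ z) := fun z hz => by
    refine Real.cos_pos_of_mem_Ioo ⟨?_, ?_⟩
    · have := hmono.monotone hz.1
      rw [hθ0] at this
      linarith [Real.pi_pos]
    · have := hmono hz.2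
      rwa [hθ.2] at this
  have hθc : ContDiff ℝ 1 θ := by
    rw [contDiff_one_iff_deriv, funext fun z => (hθd z).deriv]
    have hdiff : Differentiable ℝ θ := fun z => (hθd z).differentiableAt
    exact ⟨hdiff, (hcont.comp hdiff.continuous).inv₀ fun z =>
      (integrand_pos hK₁ hK₂ hK₃ hC _).ne'⟩
  have hφc : ContDiff ℝ 1 φ := by
    rw [contDiff_one_iff_deriv, funext fun z => (hφd z).deriv]
    exact ⟨fun z => (hφd z).differentiableAt, continuous_const.div
      ((continuous_mix _ _).comp hθc.continuous) fun z => (mix_pos hK₂ hK₃ _).ne'⟩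
  -- the horizontal part rotates with angle `φ`
  have hrot : ∀ δ, ∀ z ∈ Ioo (0 : ℝ) 1,
      N z 0 * Real.cos (φ z + δ) + N z 1 * Real.sin (φ z + δ) =
        Real.cos δ * Real.cos (θ z) := by
    intro δ z hz
    have hsub : uIcc 0 z ⊆ uIcc (0 : ℝ) 1 := by
      rw [uIcc_of_le zero_le_one, uIcc_of_le hz.1.le]
      exact Icc_subset_Icc_right hz.2.le
    have hcos' : ∀ y ∈ uIcc 0 z, Real.cos (θ y) ≠ 0 := fun y hy => by
      rw [uIcc_of_le hz.1.le] at hy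
      exact (hcosθ y ⟨hy.1, hy.2.trans_lt hz.2⟩).ne'
    -- The conserved quantity is the component of the normalised horizontal part along the direction
    -- of angle `φ + δ`. It is followed only up to `z < 1`, since `cos (θ 1) = 0`.
    have hac : AbsolutelyContinuousOnInterval (fun y =>
        N y 0 * (Real.cos (φ y + δ) / Real.cos (θ y)) +
          N y 1 * (Real.sin (φ y + δ) / Real.cos (θ y))) 0 z := by
      refine (((hN 0).mono hsub).fun_mul (ContDiffOn.absolutelyContinuousOnInterval ?_)).fun_add
        (((hN 1).mono hsub).fun_mul (ContDiffOn.absolutelyContinuousOnInterval ?_))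
      · exact ((hφc.add contDiff_const).cos.contDiffOn).div hθc.cos.contDiffOn hcos'
      · exact ((hφc.add contDiff_const).sin.contDiffOn).div hθc.cos.contDiffOn hcos'
    obtain ⟨c, hc⟩ := hac.const_of_ae_hasDerivAt_zero (by
      filter_upwards [hae, he, hne] with y hy hy' hyne hyI
      have hcy := hcos' y hyI
      have hyI' := hsub hyI
      rw [uIcc_of_le zero_le_one] at hyI'
      have hyo : y ∈ Ioo (0 : ℝ) 1 := ⟨hyI'.1.lt_of_ne' hyne.1, hyI'.2.lt_of_ne hyne.2⟩
      obtain ⟨hd, -, h0, hs, hτ, hz0⟩ := hy hyo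
      obtain ⟨hτ', hp⟩ := excess_eq_zero hK₁ hK₂ hK₃ hC (h1 y hyI') h0 hs hτ hz0 (hy' hyo)
      have hly : Real.arcsin (N y 2) = θ y := hlat hyI'
      rw [hτ'] at hτ
      rw [hly] at hs hτ hp
      have hφ' := (hφd y).add_const δ
      have hder := ((hd 0).fun_mul (hφ'.cos.fun_div (hθd y).cos hcy)).fun_add
        ((hd 1).fun_mul (hφ'.sin.fun_div (hθd y).cos hcy))
      refine hder.congr_deriv ?_
      have hu1 := h1 y hyI'
      rw [dotProduct_eq] at hu1 h0
      rw [hs] at hu1 h0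
      rw [hτ] at h0
      have hr : N y 0 ^ 2 + N y 1 ^ 2 = Real.cos (θ y) ^ 2 := by
        linarith [Real.sin_sq_add_cos_sq (θ y)]
      generalize (integrand K₁ K₂ K₃ t C (θ y))⁻¹ = τ at *
      generalize K₂ * t / mix K₂ K₃ (θ y) = ν at *
      -- The horizontal velocity is recovered from its radial part (`h0`) and angular part (`hp`),
      -- using `hr`.
      have hd0 : velocity N y 0 =
          -(Real.sin (θ y) * τ / Real.cos (θ y)) * N y 0 - ν * N y 1 := by
        field_simp
        refine mul_left_cancel₀ hcy ?_
        linear_combination (-velocity N y 0) * hr + N y 0 * h0 - N y 1 * hp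
      have hd1 : velocity N y 1 =
          -(Real.sin (θ y) * τ / Real.cos (θ y)) * N y 1 + ν * N y 0 := by
        field_simp
        refine mul_left_cancel₀ hcy ?_
        linear_combination (-velocity N y 1) * hr + N y 1 * h0 + N y 0 * hp
      rw [hd0, hd1]
      field_simp
      ring)
    have e0 := hc 0 left_mem_uIcc
    have ez := hc z right_mem_uIcc
    have hcz := hcos' z right_mem_uIcc
    rw [hN0, hφ0, hθ0] at e0
    simp at e0
    rw [← e0] at ez
    field_simp at ez
    linarith
  intro z hz
  -- The offsets `0` and `π / 2` give the components along two orthonormal directions, which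
  -- determine the horizontal part.
  have r0 := hrot 0 z hz
  have r1 := hrot (Real.pi / 2) z hz
  rw [add_zero, Real.cos_zero, one_mul] at r0
  rw [Real.cos_add_pi_div_two, Real.sin_add_pi_div_two, Real.cos_pi_div_two, zero_mul] at r1
  have hsc := Real.sin_sq_add_cos_sq (φ z)
  have hzc := Ioo_subset_Icc_self hz
  ext i
  fin_cases i
  · simp [euler]
    linear_combination Real.cos (φ z) * r0 - Real.sin (φ z) * r1 - N z 0 * hsc
  · simp [euler]
    linear_combination Real.sin (φ z) * r0 + Real.cos (φ z) * r1 - N z 1 * hsc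
  · simp only [euler]
    have := h1 z hzc
    rw [dotProduct_eq] at this
    have hs : Real.sin (Real.arcsin (N z 2)) = N z 2 :=
      Real.sin_arcsin (by nlinarith [sq_nonneg (N z 0), sq_nonneg (N z 1)])
        (by nlinarith [sq_nonneg (N z 0), sq_nonneg (N z 1)])
    rw [show Real.arcsin (N z 2) = θ z from hlat hzc] at hs
    exact hs.symm

end

section

variable {K₁ K₂ K₃ K₄ t C L₁ L₂ : ℝ}

/-! ### The explicit minimiser -/

section Euler

variable {θ φ τ ν : ℝ → ℝ}

lemma velocity_euler (hθ : ∀ z, HasDerivAt θ (τ z) z) (hφ : ∀ z, HasDerivAt φ (ν z) z) (z : ℝ) :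
    velocity (euler θ φ) z =
      ![-Real.sin (φ z) * ν z * Real.cos (θ z) + Real.cos (φ z) * (-Real.sin (θ z) * τ z),
        Real.cos (φ z) * ν z * Real.cos (θ z) + Real.sin (φ z) * (-Real.sin (θ z) * τ z),
        Real.cos (θ z) * τ z] := by
  ext i
  fin_cases i
  · exact ((hφ z).cos.fun_mul (hθ z).cos).deriv
  · exact ((hφ z).sin.fun_mul (hθ z).cos).deriv
  · exact (hθ z).sin.deriv

lemma euler_dotProduct_self (θ φ : ℝ → ℝ) (z : ℝ) : euler θ φ z ⬝ᵥ euler θ φ z = 1 := by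
  rw [dotProduct_eq]
  simp [euler]
  linear_combination Real.cos (θ z) ^ 2 * Real.sin_sq_add_cos_sq (φ z) +
    Real.sin_sq_add_cos_sq (θ z)

lemma contDiff_euler (hθ : ContDiff ℝ 1 θ) (hφ : ContDiff ℝ 1 φ) (i : Fin 3) :
    ContDiff ℝ 1 fun z => euler θ φ z i := by
  fin_cases i
  · exact hφ.cos.mul hθ.cos
  · exact hφ.sin.mul hθ.cos
  · exact hθ.sin

lemma isProfile_euler (hθ : ContDiff ℝ 1 θ) (hφ : ContDiff ℝ 1 φ) : IsProfile (euler θ φ) :=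
  fun i => (contDiff_euler hθ hφ i).contDiffOn.absolutelyContinuousOnInterval

lemma memLp_deriv_of_contDiff {f : ℝ → ℝ} (hf : ContDiff ℝ 1 f) :
    MemLp (deriv f) 2 (volume.restrict (Ioo (0 : ℝ) 1)) := by
  have hc : Continuous (deriv f) := hf.continuous_deriv le_rfl
  obtain ⟨B, hB⟩ := isCompact_Icc.exists_bound_of_continuousOn (s := Icc (0 : ℝ) 1)
    hc.continuousOn
  refine MemLp.of_bound hc.aestronglyMeasurable B ?_
  filter_upwards [ae_restrict_mem measurableSet_Ioo] with z hz
  exact hB z (Ioo_subset_Icc_self hz)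

lemma excess_euler (hK₁ : 0 < K₁) (hK₂ : 0 < K₂) (hK₃ : 0 < K₃) (hC : K₂ * t ^ 2 < C)
    (hθ : ∀ z, HasDerivAt θ (integrand K₁ K₂ K₃ t C (θ z))⁻¹ z)
    (hφ : ∀ z, HasDerivAt φ (K₂ * t / mix K₂ K₃ (θ z)) z) {z : ℝ} (hc : Real.cos (θ z) ≠ 0) :
    excess K₁ K₂ K₃ K₄ t C (euler θ φ z) (velocity (euler θ φ) z) (θ z) (deriv θ z) = 0 := by
  have hv := velocity_euler hθ hφ z
  have hsc := Real.sin_sq_add_cos_sq (φ z)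
  have h0 : euler θ φ z ⬝ᵥ velocity (euler θ φ) z = 0 := by
    rw [hv, dotProduct_eq]
    simp [euler]
    linear_combination (-Real.cos (θ z) * Real.sin (θ z) * (integrand K₁ K₂ K₃ t C (θ z))⁻¹) * hsc
  have hA := Real.sqrt_pos.2 (mix_pos hK₁ hK₃ (θ z))
  rw [(hθ z).deriv, excess_eq hK₁ hK₂ hK₃ hC (euler_dotProduct_self θ φ z) h0 (by simp [euler])
    (by rw [hv]; simp) hc]
  have hp : euler θ φ z 0 * velocity (euler θ φ) z 1 - euler θ φ z 1 * velocity (euler θ φ) z 0 =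
      Real.cos (θ z) ^ 2 * (K₂ * t / mix K₂ K₃ (θ z)) := by
    rw [hv]
    simp [euler]
    linear_combination (Real.cos (θ z) ^ 2 * (K₂ * t / mix K₂ K₃ (θ z))) * hsc
  rw [hp, mul_div_cancel_left₀ _ (pow_ne_zero 2 hc), integrand_eq, inv_div,
    mul_div_cancel₀ _ hA.ne']
  simp

end Euler

end

end OseenFrank

end

/-! ### Comparison of an arbitrary competitor with the explicit field. -/

open OseenFrank in
theorem theorem2 (K₁ K₂ K₃ K₄ t L₁ L₂ : ℝ) (hK₁ : 0 < K₁) (hK₂ : 0 < K₂) (hK₃ : 0 < K₃)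
    (hL₁ : 0 < L₁) (hL₂ : 0 < L₂) :
    (∃! C : ℝ, OseenFrank.IsNormalising K₁ K₂ K₃ t C) ∧
    ∀ C : ℝ, OseenFrank.IsNormalising K₁ K₂ K₃ t C →
      K₂ * t ^ 2 < C ∧
      ∃ θ φ : ℝ → ℝ,
        (OseenFrank.IsTheta K₁ K₂ K₃ t C θ ∧
          ∀ θ', OseenFrank.IsTheta K₁ K₂ K₃ t C θ' → Set.EqOn θ' θ (Set.Icc 0 1)) ∧
        (OseenFrank.IsPhi K₂ K₃ t θ φ ∧
          ∀ φ', OseenFrank.IsPhi K₂ K₃ t θ φ' → Set.EqOn φ' φ (Set.Icc 0 1)) ∧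
        OseenFrank.IsUniqueMinimiser K₁ K₂ K₃ K₄ t L₁ L₂ (OseenFrank.director θ φ) := by
  refine ⟨existsUnique_isNormalising hK₁ hK₂ hK₃ t, fun C hCn => ?_⟩
  have hC := hCn.lt hK₁ hK₂ hK₃
  obtain ⟨θ, hθ, hmono, hθ0, hθd⟩ := exists_theta hK₁ hK₂ hK₃ hCn
  have hθdiff : Differentiable ℝ θ := fun z => (hθd z).differentiableAt
  obtain ⟨φ, hφ, hφ0, hφd⟩ := exists_phi hK₂ hK₃ t hθdiff.continuous
  refine ⟨hC, θ, φ, ⟨hθ, fun θ' hθ' => eqOn_of_integral_integrand_eq hK₁ hK₂ hK₃ hC (fun z hz => (hθ.1 z hz).2)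
    fun z hz => (hθ'.1 z hz).2⟩, ⟨hφ, fun φ' hφ' => IsPhi.eqOn hφ hφ'⟩, ?_⟩
  have hθc : ContDiff ℝ 1 θ := by
    rw [contDiff_one_iff_deriv, funext fun z => (hθd z).deriv]
    exact ⟨hθdiff, ((continuous_integrand hK₂ hK₃ hC).comp hθdiff.continuous).inv₀ fun z =>
      (integrand_pos hK₁ hK₂ hK₃ hC _).ne'⟩
  have hφc : ContDiff ℝ 1 φ := by
    rw [contDiff_one_iff_deriv, funext fun z => (hφd z).deriv]
    exact ⟨fun z => (hφd z).differentiableAt, continuous_const.div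
      ((continuous_mix _ _).comp hθc.continuous) fun z => (mix_pos hK₂ hK₃ _).ne'⟩
  have hP := isProfile_euler hθc hφc
  have hPD := fun i => memLp_deriv_of_contDiff (contDiff_euler hθc hφc i)
  have hself : ∀ᵐ x ∂volume.restrict (cuboid L₁ L₂), director θ φ x = euler θ φ (x 2) :=
    Filter.Eventually.of_forall fun _ => rfl
  have hadm : Admissible L₁ L₂ (director θ φ) :=
    hP.admissible hL₁ hL₂ hPD (euler_dotProduct_self θ φ) (by simp [euler, hθ0, hφ0])
      (by simp [euler, hθ.2])
  refine ⟨hadm, ⟨euler θ φ, hself⟩, fun m hm hmz => ?_⟩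
  obtain ⟨N, hN, hND, hmN, hN0, hN1⟩ := exists_profile hL₁ hL₂ hm.1.1 hmz hm.2.1
  have hsphere : ∀ z ∈ Icc (0 : ℝ) 1, N z ⬝ᵥ N z = 1 := by
    have hcont : ContinuousOn (fun z => N z ⬝ᵥ N z) (Icc 0 1) := by
      simp only [dotProduct_eq]
      exact (((hN.continuousOn 0).mul (hN.continuousOn 0)).add
        ((hN.continuousOn 1).mul (hN.continuousOn 1))).add
        ((hN.continuousOn 2).mul (hN.continuousOn 2))
    -- The unit length constraint holds almost everywhere in the cuboid, and passes to every height
    -- by continuity of the profile.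
    refine eqOn_of_ae_eq_of_continuousOn hcont continuousOn_const (ae_of_ae_cuboid hL₁ hL₂ ?_)
    filter_upwards [hm.1.2, hmN] with x hx hx'
    rw [← hx', hx]
  have hexc := hN.ae_excess_nonneg (K₄ := K₄) hK₁ hK₂ hK₃ hC hsphere
  have hexc0 : ∫ z in Ioo (0 : ℝ) 1, excess K₁ K₂ K₃ K₄ t C (euler θ φ z)
      (velocity (euler θ φ) z) (θ z) (deriv θ z) = 0 := by
    refine setIntegral_eq_zero_of_forall_eq_zero fun z hz => ?_
    refine excess_euler hK₁ hK₂ hK₃ hC hθd hφd (Real.cos_pos_of_mem_Ioo ⟨?_, ?_⟩).ne'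
    · have := hmono hz.1
      rw [hθ0] at this
      linarith [Real.pi_pos]
    · have := hmono hz.2
      rwa [hθ.2] at this
  obtain ⟨-, e⟩ := hP.integral_density (K₁ := K₁) (K₄ := K₄) (t := t) (C := C) hK₂ hK₃ hPD
    hθc.contDiffOn.absolutelyContinuousOnInterval
  obtain ⟨hi, e'⟩ := hN.integral_density (K₁ := K₁) (K₄ := K₄) (t := t) (C := C) hK₂ hK₃ hND
    (hN.absolutelyContinuous_arcsin hsphere)
  -- Both curves have latitudes `0` and `π / 2` at the ends, so the boundary terms agree and the
  -- energy gap is the area of the base times the integrated excess of the competitor.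
  have ha0 : Real.arcsin (N 0 2) = 0 := by simp [hN0]
  have ha1 : Real.arcsin (N 1 2) = Real.pi / 2 := by simp [hN1]
  rw [hexc0, hθ0, hθ.2, add_zero] at e
  rw [ha0, ha1, ← e] at e'
  have hκ := toReal_volume_face_pos hL₁ hL₂
  rw [hP.energy_eq hL₁ hL₂ hPD hself, hN.energy_eq hL₁ hL₂ hND hmN, e']
  refine ⟨mul_le_mul_of_nonneg_left (le_add_of_nonneg_right (integral_nonneg_of_ae hexc)) hκ.le,
    fun heq => ?_⟩
  have hzero := add_eq_left.1 (mul_left_cancel₀ hκ.ne' heq)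
  have hae := (integral_eq_zero_iff_of_nonneg_ae hexc hi).1 hzero
  have hEq := eqOn_euler hK₁ hK₂ hK₃ hC hθ hmono hθ0 hθd hφ0 hφd hN hsphere hN0 hae
  have hNe : ∀ᵐ z ∂volume.restrict (Ioo (0 : ℝ) 1), N z = euler θ φ z := by
    filter_upwards [ae_restrict_mem measurableSet_Ioo] with z hz using hEq hz
  filter_upwards [hmN, ae_cuboid_of_ae hNe] with x hx hx'
  rw [hx, hx']
  rfl
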